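/- Let $(X,\mathcal B,\mu)$ be a standard Borel probability space with $\mu$ non-atomic, let $T:X\to X$ be an ergodic (invertible, $\mu$-preserving) automorphism, and let $f:X\to(0,\infty)$ be measurable with $f\in L^2(X,\mu)$. For $n\in\mathbb Z$ put $f^{(n)}(x)=\sum_{i=0}^{n-1}f(T^ix)$ if $n>0$, $f^{(0)}=0$, and $f^{(n)}(x)=-\sum_{i=1}^{-n}f(T^{-i}x)$ if $n<0$. The special flow $T^f=(T^f_t)_{t\in\mathbb R}$ acts on $X^f=\{(x,r)\in X\times\mathbb R:0\le r<f(x)\}$, equipped with the restriction $\mu^f$ of $\mu\otimes\mathrm{Leb}$, by $T^f_t(x,r)=(T^nx,\,r+t-f^{(n)}(x))$, where $n\in\mathbb Z$ is the unique integer with $0\le r+t-f^{(n)}(x)<f(T^nx)$ (it exists for almost every $(x,r)$). Suppose that there are measurable sets $W_n\subset X$, a strictly increasing sequence $(q_n)_{n\in\mathbb N}$ of natural numbers, a real sequence $(a_n)_{n\in\mathbb N}$, a number $0<\alpha\le 1$ and a Borel probability measure $P$ on $\mathbb R^2$ such that, with $q_n'=2q_n$, $a_n'=2a_n$, $f_n=f^{(q_n)}-a_n$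 and $f_n'=f^{(q_n')}-a_n'$: 1. $\mu(W_n)\to\alpha$; 2. $\mu(W_n\triangle T^{-1}W_n)\to0$; 3. $\mu\big((T^{-q_n}A\triangle A)\cap W_n\big)\to0$ for every $A\in\mathcal B$; 4. $\mu\big((T^{-q_n'}A\triangle A)\cap W_n\big)\to0$ for every $A\in\mathcal B$; 5. the sequence $\int_{W_n}|f_n|^2\,d\mu$ is bounded; 6. the sequence $\int_{W_n}|f_n'|^2\,d\mu$ is bounded; 7. $(f_n',f_n)_*\,\mu(\,\cdot\mid W_n)\to P$ weakly as measures on $\mathbb R^2$. Let $\xi:\mathbb R^2\to\mathbb R$, $\xi(x,y)=x-2y$, and suppose that $\xi_*P=\sum_{i=0}^m c_i\delta_{d_i}$ for some integer $m\ge 0$, weights $c_i\ge0$ and reals $d_i$ with $d_0=0$, $\sum_{i=1}^m c_i>\frac{1-\alpha}{\alpha}$ and $d_i\ne-d_j$ for all $i\ne j$. Then the special flow $T^f$ is not isomorphic to its inverse: there is no $\mu^f$-preserving map $S:X^f\to X^f$, invertible modulo null sets, such that for every $t\in\mathbb R$ one has $S\circ T^f_t=T^f_{-t}\circ S$ $\mu^f$-almost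 everywhere. -/

import Mathlib

open MeasureTheory ProbabilityTheory Filter Topology
open scoped symmDiff BoundedContinuousFunction

noncomputable section

/-- The integer iterate `T^n x` of an invertible map. -/
def iter {X : Type*} [MeasurableSpace X] (T : X ≃ᵐ X) (n : ℤ) (x : X) : X :=
  ((T.toEquiv : Equiv.Perm X) ^ n) x

/-- The cocycle `f^{(n)}`: it is `f(x) + f(Tx) + ⋯ + f(T^{n-1}x)` for `n > 0`, it is `0` for
`n = 0`, and it is `-(f(T^{-1}x) + ⋯ + f(T^n x))` for `n < 0`. -/
def cocycle {X : Type*} [MeasurableSpace X] (T : X ≃ᵐ X) (f : X → ℝ) : ℤ → X → ℝ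
  | Int.ofNat n, x => ∑ i ∈ Finset.range n, f (iter T (i : ℤ) x)
  | Int.negSucc n, x => -∑ i ∈ Finset.range (n + 1), f (iter T (-((i : ℤ) + 1)) x)

/-- The space `X^f = {(x, r) : 0 ≤ r < f x}` under the graph of the roof function, with the
σ-algebra restricted from `X × ℝ`. -/
abbrev SpecialSpace {X : Type*} (f : X → ℝ) : Type _ :=
  {p : X × ℝ // 0 ≤ p.2 ∧ p.2 < f p.1}

/-- The measure `μ^f`: the restriction of `μ ⊗ Leb` to `X^f`. -/
def specialMeasure {X : Type*} [MeasurableSpace X] (μ : Measure X) (f : X → ℝ) :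
    Measure (SpecialSpace f) :=
  Measure.comap Subtype.val (μ.prod (volume : Measure ℝ))

open Classical in
/-- The special flow `T^f`: the point `(x, r)` moves vertically with unit speed, and `(x, f x)` is
identified with `(T x, 0)`. Thus `T^f_t (x, r) = (T^n x, r + t - f^{(n)}(x))` for the integer `n`
(unique when `f > 0`) such that this point lies in `X^f`. When `T` is ergodic and `f > 0` is
integrable, such an `n` exists for every `t` and every `r`, for almost every `x`; at the
remaining points the map is, by convention, the identity. -/
def specialFlow {X : Type*} [MeasurableSpace X] (T : X ≃ᵐ X) (f : X → ℝ) (t : ℝ)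
    (p : SpecialSpace f) : SpecialSpace f :=
  if h : ∃ n : ℤ, 0 ≤ p.1.2 + t - cocycle T f n p.1.1 ∧
      p.1.2 + t - cocycle T f n p.1.1 < f (iter T n p.1.1) then
    ⟨(iter T h.choose p.1.1, p.1.2 + t - cocycle T f h.choose p.1.1), h.choose_spec⟩
  else p

/-- Two flows on measure spaces `(Y, ν)` and `(Z, κ)` are isomorphic: there is an invertible (mod
null sets) measure-preserving map that intertwines them, almost everywhere for each time. -/
def FlowIsomorphic {Y Z : Type*} [MeasurableSpace Y] [MeasurableSpace Z]
    (ν : Measure Y) (φ : ℝ → Y → Y) (κ : Measure Z) (ψ : ℝ → Z → Z) : Prop :=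
  ∃ (S : Y → Z) (R : Z → Y),
    MeasurePreserving S ν κ ∧ MeasurePreserving R κ ν ∧
    (∀ᵐ y ∂ν, R (S y) = y) ∧ (∀ᵐ z ∂κ, S (R z) = z) ∧
    ∀ t : ℝ, ∀ᵐ y ∂ν, S (φ t y) = ψ t (S y)

/-- The increasing sequence `q` is a rigidity sequence for `T` along the sequence of sets `W`. -/
def IsRigiditySequenceAlong {X : Type*} [MeasurableSpace X] (μ : Measure X) (T : X ≃ᵐ X)
    (q : ℕ → ℕ) (W : ℕ → Set X) : Prop :=
  StrictMono q ∧ ∀ A : Set X, MeasurableSet A →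
    Tendsto (fun n => μ ((((iter T (q n)) ⁻¹' A) ∆ A) ∩ W n)) atTop (𝓝 0)

/-- Weak convergence of (finite) measures, tested on bounded continuous functions. -/
def WeaklyConverges {E : Type*} [TopologicalSpace E] [MeasurableSpace E]
    (Q : ℕ → Measure E) (P : Measure E) : Prop :=
  ∀ φ : E →ᵇ ℝ, Tendsto (fun n => ∫ z, φ z ∂(Q n)) atTop (𝓝 (∫ z, φ z ∂P))

/-- The conditions relating the sets `W n`, the times `q n`, `q' n`, the constants `a n`, `a' n`,
the number `α` and the measure `P` on the plane. -/
structure PartialRigidityConditions {X : Type*} [MeasurableSpace X] (μ : Measure X)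
    (T : X ≃ᵐ X) (f : X → ℝ) (W : ℕ → Set X) (q q' : ℕ → ℕ) (a a' : ℕ → ℝ) (α : ℝ)
    (P : Measure (ℝ × ℝ)) : Prop where
  /-- `μ(W_n) → α` with `0 < α ≤ 1` -/
  pos : 0 < α
  le_one : α ≤ 1
  tendsto_measure : Tendsto (fun n => μ.real (W n)) atTop (𝓝 α)
  /-- `μ(W_n ∆ T⁻¹ W_n) → 0` -/
  almost_invariant : Tendsto (fun n => μ (W n ∆ (T ⁻¹' W n))) atTop (𝓝 0)
  rigid : IsRigiditySequenceAlong μ T q W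
  rigid' : IsRigiditySequenceAlong μ T q' W
  /-- the integrals over `W_n` of `|f_n|²`, where `f_n = f^{(q_n)} - a_n`, are bounded -/
  bounded : ∃ D : ℝ, ∀ n, ∫ x in W n, |cocycle T f (q n) x - a n| ^ 2 ∂μ ≤ D
  /-- the integrals over `W_n` of `|f_n'|²`, where `f_n' = f^{(q_n')} - a_n'`, are bounded -/
  bounded' : ∃ D : ℝ, ∀ n, ∫ x in W n, |cocycle T f (q' n) x - a' n| ^ 2 ∂μ ≤ D
  /-- `(f_n', f_n)_* μ_{W_n} → P` weakly, where `μ_{W_n} = μ( · | W_n)` -/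
  weak_limit : WeaklyConverges
    (fun n => (μ[|W n]).map
      (fun x => (cocycle T f (q' n) x - a' n, cocycle T f (q n) x - a n))) P

end

/-! Suppose `S` conjugates the flow to its inverse, and let `J(t,u)` be the law of `(y, T^f_t y,
T^f_u y)`. The argument compares two lower bounds for the joinings `ν_n = J(2a_n, a_n)`.

First bound. The point `(x, r + a_n)` of the suspension `X × ℝ` represents the same point of `X^f`
as `(T^{q_n} x, r - f_n(x))`, and over `W_n` the map `T^{q_n}` is nearly the identity. So over `W_n`
flowing for time `a_n` is nearly a descent by `f_n(x)`, and for time `2a_n` a descent by `f_n'(x)`.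
The pair `(f_n', f_n)` converges in law to `P`, and even stably: since `f_n ∘ T - f_n = f ∘ T^{q_n}
- f` is small on `W_n`, functions of the pair cut off to `W_n` are almost `T`-invariant, hence by
ergodicity asymptotically uncorrelated with every fixed set. Therefore `liminf ν_n ≥ α ∫ J(-x,-y)
dP(x,y)` on measurable boxes (`mixture_le_liminf_flowJoining`).

Second bound. Applying `S` to all coordinates reverses the times, and flowing on by `2a_n` turns
times `(0, -2a_n, -a_n)` into `(2a_n, 0, a_n)`. Thus `ν_n` is carried to itself with its first two
coordinates exchanged (`flowJoining_preimage_conjugacy`); this is where `a_n' = 2a_n` matters. The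
same transformation sends `J(-x,-y)` to `J(-x,-(x-y))`, so `ν_n` also asymptotically dominates the
mixture over the image of `P` under `τ(x,y) = (x, x-y)`.

Contradiction. As `ξ ∘ τ = -ξ`, the `ξ`-image of `τ_*P` is the reflection of `∑ c_i δ_{d_i}`. The
flow is free almost everywhere, so mixtures over disjoint sets of times live on disjoint sets of
triples (`exists_measurableSet_separating_mixedJoining`). Separate by `D = ξ⁻¹{d_0, …, d_m}`: `P` is
carried by `D`, while `τ_*P` gives `Dᶜ` at least `∑_{i≥1} c_i`. Two measures dominated by the same
`ν_n` cannot have complementary masses adding up to more than that of `ν_n`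
(`measure_add_measure_compl_le_of_le_liminf`), so `α + α ∑_{i≥1} c_i ≤ 1`, against the hypothesis on
the weights. -/

noncomputable section

/-! ### Cocycle identities and almost sure completeness of flow lines. -/

section Iterates

variable {X : Type*} [MeasurableSpace X] {T : X ≃ᵐ X} {f : X → ℝ}

lemma iter_zero (x : X) : iter T 0 x = x := by simp [iter]

lemma iter_one (x : X) : iter T 1 x = T x := by simp [iter]

lemma iter_add (m n : ℤ) (x : X) : iter T (m + n) x = iter T m (iter T n x) := by
  simp [iter, zpow_add]

lemma iter_neg_one (x : X) : iter T (-1) x = T.symm x := by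
  simp only [iter, zpow_neg, zpow_one]
  rfl

lemma iter_natCast (n : ℕ) (x : X) : iter T n x = T^[n] x := by
  induction n with
  | zero => simp [iter_zero]
  | succ n ih =>
    rw [Function.iterate_succ_apply', ← ih, ← iter_one (T := T), ← iter_add]
    push_cast
    rw [add_comm]

lemma iter_neg_natCast (n : ℕ) (x : X) : iter T (-n) x = T.symm^[n] x := by
  induction n with
  | zero => simp [iter_zero]
  | succ n ih =>
    rw [Function.iterate_succ_apply', ← ih, ← iter_neg_one (T := T), ← iter_add]
    push_cast
    congr 1
    ring

lemma iter_neg_iter (n : ℤ) (x : X) : iter T (-n) (iter T n x) = x := by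
  rw [← iter_add, neg_add_cancel, iter_zero]

lemma iter_iter_neg (n : ℤ) (x : X) : iter T n (iter T (-n) x) = x := by
  rw [← iter_add, add_neg_cancel, iter_zero]

lemma measurePreserving_iter {μ : Measure X} (hT : MeasurePreserving T μ μ) (n : ℤ) :
    MeasurePreserving (iter T n) μ μ := by
  obtain ⟨n, rfl | rfl⟩ := n.eq_nat_or_neg
  · exact (funext (iter_natCast n) : iter T n = T^[n]) ▸ hT.iterate n
  · exact (funext (iter_neg_natCast n) : iter T (-n) = T.symm^[n]) ▸ (hT.symm T).iterate n

lemma measurable_iter (T : X ≃ᵐ X) (n : ℤ) : Measurable (iter T n) := by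
  obtain ⟨n, rfl | rfl⟩ := n.eq_nat_or_neg
  · exact (funext (iter_natCast n) : iter T n = T^[n]) ▸ T.measurable.iterate n
  · exact (funext (iter_neg_natCast n) : iter T (-n) = T.symm^[n]) ▸ T.symm.measurable.iterate n

lemma cocycle_zero (x : X) : cocycle T f 0 x = 0 := by
  change cocycle T f (Int.ofNat 0) x = 0
  simp [cocycle]

lemma cocycle_natCast (n : ℕ) (x : X) :
    cocycle T f n x = ∑ i ∈ Finset.range n, f (iter T (i : ℤ) x) := rfl

lemma cocycle_succ (n : ℤ) (x : X) :
    cocycle T f (n + 1) x = cocycle T f n x + f (iter T n x) := by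
  obtain n | n := n
  · change cocycle T f (Int.ofNat (n + 1)) x = _
    simp [cocycle, Finset.sum_range_succ]
  · obtain _ | n := n
    · change cocycle T f 0 x = _
      rw [cocycle_zero]
      simp [cocycle]
    · change cocycle T f (Int.negSucc n) x = _
      simp only [cocycle]
      rw [Finset.sum_range_succ _ (n + 1), Int.negSucc_eq]
      push_cast
      ring

lemma cocycle_one (x : X) : cocycle T f 1 x = f x := by
  simpa [cocycle_zero, iter_zero] using cocycle_succ (T := T) (f := f) 0 x

lemma cocycle_add (m n : ℤ) (x : X) :
    cocycle T f (m + n) x = cocycle T f n x + cocycle T f m (iter T n x) := by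
  induction m using Int.induction_on with
  | zero => simp [cocycle_zero]
  | succ m ih =>
    rw [show (m : ℤ) + 1 + n = (m + n) + 1 by ring, cocycle_succ, cocycle_succ, ih, iter_add]
    ring
  | pred m ih =>
    have h1 := cocycle_succ (T := T) (f := f) (-(m : ℤ) - 1 + n) x
    have h2 := cocycle_succ (T := T) (f := f) (-(m : ℤ) - 1) (iter T n x)
    rw [show -(m : ℤ) - 1 + n + 1 = -m + n by ring, ih, iter_add] at h1
    rw [sub_add_cancel] at h2
    linarith

lemma measurable_cocycle (T : X ≃ᵐ X) (hf : Measurable f) (n : ℤ) :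
    Measurable (cocycle T f n) := by
  obtain n | n := n
  · exact Finset.measurable_fun_sum _ fun i _ => hf.comp (measurable_iter T _)
  · exact (Finset.measurable_fun_sum _ fun i _ => hf.comp (measurable_iter T _)).neg

lemma cocycle_strictMono (hf : ∀ x, 0 < f x) (x : X) : StrictMono fun n => cocycle T f n x :=
  strictMono_int_of_lt_succ fun n => by
    rw [cocycle_succ]
    exact lt_add_of_pos_right _ (hf _)

/-- The flow time `s`, measured from the base point `x`, is reached during the `n`-th passage
under the graph of the roof function. -/
def InPassage (T : X ≃ᵐ X) (f : X → ℝ) (x : X) (s : ℝ) (n : ℤ) : Prop :=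
  cocycle T f n x ≤ s ∧ s < cocycle T f (n + 1) x

lemma inPassage_iff (x : X) (s : ℝ) (n : ℤ) : InPassage T f x s n ↔
    0 ≤ s - cocycle T f n x ∧ s - cocycle T f n x < f (iter T n x) := by
  rw [InPassage, cocycle_succ, sub_nonneg, sub_lt_iff_lt_add']

lemma InPassage.unique (hf : ∀ x, 0 < f x) {x : X} {s : ℝ} {m n : ℤ} (hm : InPassage T f x s m)
    (hn : InPassage T f x s n) : m = n := by
  have h1 := (cocycle_strictMono (T := T) hf x).lt_iff_lt.1 (hm.1.trans_lt hn.2)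
  have h2 := (cocycle_strictMono (T := T) hf x).lt_iff_lt.1 (hn.1.trans_lt hm.2)
  omega

lemma inPassage_iter {x : X} {s : ℝ} {m n : ℤ} :
    InPassage T f (iter T m x) s n ↔ InPassage T f x (s + cocycle T f m x) (n + m) := by
  rw [inPassage_iff, inPassage_iff, cocycle_add, iter_add,
    show s + cocycle T f m x - (cocycle T f m x + cocycle T f n (iter T m x)) =
      s - cocycle T f n (iter T m x) by ring]

lemma inPassage_zero {x : X} {s : ℝ} (h0 : 0 ≤ s) (h1 : s < f x) : InPassage T f x s 0 := by
  simpa [inPassage_iff, cocycle_zero, iter_zero] using ⟨h0, h1⟩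

/-- The flow line through `x` is defined for all times. -/
def Complete (T : X ≃ᵐ X) (f : X → ℝ) (x : X) : Prop := ∀ s : ℝ, ∃ n, InPassage T f x s n

lemma Complete.iter {x : X} (h : Complete T f x) (m : ℤ) : Complete T f (iter T m x) := by
  intro s
  obtain ⟨n, hn⟩ := h (s + cocycle T f m x)
  exact ⟨n - m, inPassage_iter.2 (by rwa [sub_add_cancel])⟩

/-- Sums of positive numbers, infinitely many of which exceed a fixed positive number, diverge. -/
lemma tendsto_sum_range_atTop_of_frequently {u : ℕ → ℝ} (hu : ∀ n, 0 ≤ u n) {ε : ℝ} (hε : 0 < ε)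
    (h : ∃ᶠ n in atTop, ε < u n) :
    Tendsto (fun n => ∑ i ∈ Finset.range n, u i) atTop atTop := by
  have hmono : Monotone fun n => ∑ i ∈ Finset.range n, u i :=
    monotone_nat_of_le_succ fun n => by simp [Finset.sum_range_succ, hu n]
  rcases tendsto_atTop_of_monotone hmono with h' | ⟨l, hl⟩
  · exact h'
  · have : Summable u := ⟨l, (hasSum_iff_tendsto_nat_of_nonneg hu l).2 hl⟩
    have h0 := this.tendsto_atTop_zero.eventually (gt_mem_nhds hε)
    obtain ⟨n, h1, h2⟩ := (h.and_eventually h0).exists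
    exact absurd h1 (not_lt.2 h2.le)

/-- Poincaré recurrence: almost every point of `{f > 1/(k+1)}` returns there infinitely often, and
positivity of `f` puts every point in one of these sets. -/
lemma ae_tendsto_birkhoff_sum_atTop {μ : Measure X} [IsFiniteMeasure μ] {g : X → X}
    (hg : MeasurePreserving g μ μ) (hfm : Measurable f) (hf : ∀ x, 0 < f x) :
    ∀ᵐ x ∂μ, Tendsto (fun n => ∑ i ∈ Finset.range n, f (g^[i] x)) atTop atTop := by
  have key : ∀ k : ℕ, ∀ᵐ x ∂μ, x ∈ {y | 1 / ((k : ℝ) + 1) < f y} →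
      ∃ᶠ n in atTop, g^[n] x ∈ {y | 1 / ((k : ℝ) + 1) < f y} := fun k =>
    hg.conservative.ae_mem_imp_frequently_image_mem
      (measurableSet_lt measurable_const hfm).nullMeasurableSet
  filter_upwards [ae_all_iff.2 key] with x hx
  obtain ⟨k, hk⟩ := exists_nat_one_div_lt (hf x)
  exact tendsto_sum_range_atTop_of_frequently (fun n => (hf _).le)
    Nat.one_div_pos_of_nat (hx k hk)

/-- The sums diverge in both time directions, so the increasing sequence `cocycle T f n x` is
unbounded above and below, and the passage containing `s` is the last `n` with `cocycle T f n x ≤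
s`. -/
lemma ae_complete {μ : Measure X} [IsFiniteMeasure μ] (hT : MeasurePreserving T μ μ)
    (hfm : Measurable f) (hf : ∀ x, 0 < f x) : ∀ᵐ x ∂μ, Complete T f x := by
  -- The backward sum starts at `T⁻¹ x`, because the cocycle at negative times begins with `f (T⁻¹
  -- x)`.
  have h2 : ∀ᵐ x ∂μ, Tendsto (fun n => ∑ i ∈ Finset.range n, f (T.symm^[i] (T.symm x)))
      atTop atTop :=
    (hT.symm T).quasiMeasurePreserving.ae (ae_tendsto_birkhoff_sum_atTop (hT.symm T) hfm hf)
  filter_upwards [ae_tendsto_birkhoff_sum_atTop hT hfm hf, h2] with x h1 h2 s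
  obtain ⟨n, hn⟩ := (h1.eventually_gt_atTop s).exists
  obtain ⟨k, hk⟩ := (h2.eventually_gt_atTop (-s)).exists
  have hup : s < cocycle T f n x := by
    rw [cocycle_natCast]
    simpa only [iter_natCast] using hn
  have hlow : cocycle T f (-k) x ≤ s := by
    obtain _ | k := k
    · have : -s < 0 := by simpa using hk
      simpa [cocycle_zero] using by linarith
    · have h3 : cocycle T f (-((k + 1 : ℕ) : ℤ)) x =
          -∑ i ∈ Finset.range (k + 1), f (T.symm^[i] (T.symm x)) := by
        change cocycle T f (Int.negSucc k) x = _
        simp only [cocycle]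
        congr 1
      rw [h3]
      linarith
  obtain ⟨m, hm1, hm2⟩ := Int.exists_greatest_of_bdd (P := fun m => cocycle T f m x ≤ s)
    ⟨n, fun m hm => ((cocycle_strictMono (T := T) hf x).lt_iff_lt.1 (hm.trans_lt hup)).le⟩
    ⟨-k, hlow⟩
  refine ⟨m, hm1, ?_⟩
  by_contra hcon
  have := hm2 (m + 1) (not_lt.1 hcon)
  omega

end Iterates

/-- A function that agrees with a measurable function on each set of a countable measurable cover
is measurable. -/
lemma measurable_of_eqOn_countable_cover {α β ι : Type*} [MeasurableSpace α] [MeasurableSpace β]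
    [Countable ι] {F : α → β} (S : ι → Set α) (hS : ∀ i, MeasurableSet (S i))
    (hcover : ∀ z, ∃ i, z ∈ S i) (g : ι → α → β) (hg : ∀ i, Measurable (g i))
    (hF : ∀ i, Set.EqOn F (g i) (S i)) : Measurable F := by
  intro A hA
  have : F ⁻¹' A = ⋃ i, S i ∩ g i ⁻¹' A := by
    ext z
    simp only [Set.mem_preimage, Set.mem_iUnion, Set.mem_inter_iff]
    constructor
    · intro h
      obtain ⟨i, hi⟩ := hcover z
      exact ⟨i, hi, hF i hi ▸ h⟩
    · rintro ⟨i, hi, h⟩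
      rwa [hF i hi]
  rw [this]
  exact MeasurableSet.iUnion fun i => (hS i).inter (hg i hA)

/-! ### The special flow as translation on a quotient of `X × ℝ`. -/

section Flow

variable {X : Type*} [MeasurableSpace X] {T : X ≃ᵐ X} {f : X → ℝ}

lemma specialFlow_of_inPassage (hf : ∀ x, 0 < f x) {t : ℝ} {p : SpecialSpace f} {n : ℤ}
    (h : InPassage T f p.1.1 (p.1.2 + t) n) :
    (specialFlow T f t p).1 = (iter T n p.1.1, p.1.2 + t - cocycle T f n p.1.1) := by
  have hex : ∃ n : ℤ, 0 ≤ p.1.2 + t - cocycle T f n p.1.1 ∧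
      p.1.2 + t - cocycle T f n p.1.1 < f (iter T n p.1.1) := ⟨n, (inPassage_iff _ _ _).1 h⟩
  have hn : hex.choose = n := ((inPassage_iff _ _ _).2 hex.choose_spec).unique hf h
  rw [specialFlow, dif_pos hex]
  simp only [hn]

lemma specialFlow_of_not_inPassage {t : ℝ} {p : SpecialSpace f}
    (h : ¬ ∃ n, InPassage T f p.1.1 (p.1.2 + t) n) : specialFlow T f t p = p := by
  rw [specialFlow, dif_neg]
  simpa only [inPassage_iff] using h

/-- The parametrization of the special space by the base point of a flow line and the time. -/
def flowFrom (T : X ≃ᵐ X) (hf : ∀ x, 0 < f x) (z : X × ℝ) : SpecialSpace f :=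
  specialFlow T f z.2 ⟨(z.1, 0), le_rfl, hf z.1⟩

lemma flowFrom_of_inPassage (hf : ∀ x, 0 < f x) {x : X} {s : ℝ} {n : ℤ}
    (h : InPassage T f x s n) :
    (flowFrom T hf (x, s)).1 = (iter T n x, s - cocycle T f n x) := by
  rw [flowFrom, specialFlow_of_inPassage hf (n := n) (by simpa using h)]
  simp

lemma specialFlow_eq_flowFrom (hf : ∀ x, 0 < f x) {t : ℝ} {p : SpecialSpace f}
    (h : Complete T f p.1.1) : specialFlow T f t p = flowFrom T hf (p.1.1, p.1.2 + t) := by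
  obtain ⟨n, hn⟩ := h (p.1.2 + t)
  exact Subtype.ext ((specialFlow_of_inPassage hf hn).trans (flowFrom_of_inPassage hf hn).symm)

lemma flowFrom_coe (hf : ∀ x, 0 < f x) (p : SpecialSpace f) : flowFrom T hf p.1 = p := by
  refine Subtype.ext ?_
  have := flowFrom_of_inPassage hf (inPassage_zero (T := T) p.2.1 p.2.2)
  simpa [iter_zero, cocycle_zero] using this

/-- This makes `X^f` the quotient of `X × ℝ` by a `ℤ`-action, with the special flow induced by
vertical translation; the group law and the rigidity estimate both rest on it. -/
lemma flowFrom_iter (hf : ∀ x, 0 < f x) {x : X} (h : Complete T f x) (n : ℤ) (s : ℝ) :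
    flowFrom T hf (iter T n x, s - cocycle T f n x) = flowFrom T hf (x, s) := by
  obtain ⟨m, hm⟩ := h.iter n (s - cocycle T f n x)
  refine Subtype.ext ?_
  rw [flowFrom_of_inPassage hf hm, flowFrom_of_inPassage hf
    (n := m + n) (by simpa using inPassage_iter.1 hm), iter_add, cocycle_add]
  congr 1
  ring

lemma complete_flowFrom (hf : ∀ x, 0 < f x) {x : X} (h : Complete T f x) (s : ℝ) :
    Complete T f (flowFrom T hf (x, s)).1.1 := by
  obtain ⟨n, hn⟩ := h s
  rw [flowFrom_of_inPassage hf hn]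
  exact h.iter n

lemma specialFlow_flowFrom (hf : ∀ x, 0 < f x) {x : X} (h : Complete T f x) (s t : ℝ) :
    specialFlow T f t (flowFrom T hf (x, s)) = flowFrom T hf (x, s + t) := by
  rw [specialFlow_eq_flowFrom hf (complete_flowFrom hf h s)]
  obtain ⟨n, hn⟩ := h s
  rw [flowFrom_of_inPassage hf hn, ← flowFrom_iter hf h n (s + t)]
  congr 2
  ring

lemma specialFlow_specialFlow (hf : ∀ x, 0 < f x) {p : SpecialSpace f}
    (h : Complete T f p.1.1) (s t : ℝ) :
    specialFlow T f t (specialFlow T f s p) = specialFlow T f (s + t) p := by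
  rw [specialFlow_eq_flowFrom hf h, specialFlow_flowFrom hf h, specialFlow_eq_flowFrom hf h,
    add_assoc]

lemma specialFlow_zero (hf : ∀ x, 0 < f x) (p : SpecialSpace f) : specialFlow T f 0 p = p := by
  refine Subtype.ext ?_
  rw [specialFlow_of_inPassage hf (n := 0) (inPassage_zero (by simpa using p.2.1)
    (by simpa using p.2.2))]
  simp [iter_zero, cocycle_zero]

lemma measurableSet_inPassage (T : X ≃ᵐ X) (hfm : Measurable f) (n : ℤ) :
    MeasurableSet {z : X × ℝ | InPassage T f z.1 z.2 n} :=
  (measurableSet_le ((measurable_cocycle T hfm n).comp measurable_fst) measurable_snd).inter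
    (measurableSet_lt measurable_snd ((measurable_cocycle T hfm (n + 1)).comp measurable_fst))

/-- The special flow is jointly measurable. -/
lemma measurable_specialFlow (hf : ∀ x, 0 < f x) (hfm : Measurable f) :
    Measurable fun z : ℝ × SpecialSpace f => specialFlow T f z.1 z.2 := by
  -- One piece for each passage index, and `none` for the points where the flow is the identity by
  -- convention.
  let S : Option ℤ → Set (ℝ × SpecialSpace f) := fun o => match o with
    | some n => {z | InPassage T f z.2.1.1 (z.2.1.2 + z.1) n}
    | none => {z | ¬ ∃ n, InPassage T f z.2.1.1 (z.2.1.2 + z.1) n}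
  have hS' : ∀ n : ℤ,
      MeasurableSet {z : ℝ × SpecialSpace f | InPassage T f z.2.1.1 (z.2.1.2 + z.1) n} :=
    fun n => (measurableSet_inPassage T hfm n).preimage
      (f := fun z : ℝ × SpecialSpace f => (z.2.1.1, z.2.1.2 + z.1)) (by fun_prop)
  have hS : ∀ o, MeasurableSet (S o) := by
    rintro (_ | n)
    · have : S none = (⋃ n, S (some n))ᶜ := by
        ext z
        simp [S]
      rw [this]
      exact (MeasurableSet.iUnion fun n => hS' n).compl
    · exact hS' n
  refine Measurable.subtype_mk (p := fun p : X × ℝ => 0 ≤ p.2 ∧ p.2 < f p.1)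
    (f := fun z : ℝ × SpecialSpace f => (specialFlow T f z.1 z.2).1)
    (h := fun z => (specialFlow T f z.1 z.2).2) ?_
  refine measurable_of_eqOn_countable_cover S hS (fun z => ?_)
    (fun o => match o with
      | some n => fun z => (iter T n z.2.1.1, z.2.1.2 + z.1 - cocycle T f n z.2.1.1)
      | none => fun z => z.2.1) ?_ ?_
  · by_cases h : ∃ n, InPassage T f z.2.1.1 (z.2.1.2 + z.1) n
    · exact ⟨some h.choose, h.choose_spec⟩
    · exact ⟨none, h⟩
  · rintro (_ | n)
    · exact measurable_subtype_coe.comp measurable_snd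
    · have h1 := (measurable_iter T n).comp (f := fun z : ℝ × SpecialSpace f => z.2.1.1)
        (by fun_prop)
      have h2 := (measurable_cocycle T hfm n).comp (f := fun z : ℝ × SpecialSpace f => z.2.1.1)
        (by fun_prop)
      exact h1.prodMk (Measurable.sub (by fun_prop) h2)
  · rintro (_ | n) z hz
    · simp only [specialFlow_of_not_inPassage hz]
    · exact specialFlow_of_inPassage hf hz

end Flow

lemma measure_congr_of_ae_iff {Z : Type*} [MeasurableSpace Z] {m : Measure Z} {A B : Set Z}
    (h : ∀ᵐ z ∂m, z ∈ A ↔ z ∈ B) : m A = m B :=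
  measure_congr (eventuallyEq_set.2 h)

/-! ### The special measure and its invariance under the flow. -/

section SpecialMeasure

variable {X : Type*} [MeasurableSpace X] {T : X ≃ᵐ X} {f : X → ℝ} {μ : Measure X}

lemma measurableSet_underGraph (hfm : Measurable f) :
    MeasurableSet {p : X × ℝ | 0 ≤ p.2 ∧ p.2 < f p.1} :=
  (measurableSet_le measurable_const measurable_snd).inter
    (measurableSet_lt measurable_snd (hfm.comp measurable_fst))

lemma specialMeasure_apply (hfm : Measurable f) (E : Set (SpecialSpace f)) :
    specialMeasure μ f E = μ.prod volume (Subtype.val '' E) :=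
  (MeasurableEmbedding.subtype_coe (measurableSet_underGraph hfm)).comap_apply _ _

lemma specialMeasure_preimage (hfm : Measurable f) (E : Set (X × ℝ)) :
    specialMeasure μ f (Subtype.val ⁻¹' E) =
      μ.prod volume (E ∩ {p : X × ℝ | 0 ≤ p.2 ∧ p.2 < f p.1}) := by
  rw [specialMeasure_apply hfm]
  congr 1
  ext z
  constructor
  · rintro ⟨y, hy, rfl⟩
    exact ⟨hy, y.2⟩
  · exact fun hz => ⟨⟨z, hz.2⟩, hz.1, rfl⟩

lemma ae_prod_of_ae_fst {Z : Type*} [MeasurableSpace Z] {ν : Measure Z} [SFinite ν]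
    {p : X → Prop} (h : ∀ᵐ x ∂μ, p x) : ∀ᵐ z ∂μ.prod ν, p z.1 :=
  Measure.quasiMeasurePreserving_fst.ae h

lemma ae_specialMeasure_of_ae (hfm : Measurable f) {p : X → Prop} (h : ∀ᵐ x ∂μ, p x) :
    ∀ᵐ y ∂specialMeasure μ f, p y.1.1 := by
  have := ae_prod_of_ae_fst (ν := (volume : Measure ℝ)) h
  rw [ae_iff] at this ⊢
  refine le_antisymm ((specialMeasure_preimage hfm {z | ¬ p z.1}).trans_le ?_) zero_le
  exact (measure_mono Set.inter_subset_left).trans this.le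

lemma specialMeasure_univ [SFinite μ] (hfm : Measurable f) :
    specialMeasure μ f Set.univ = ∫⁻ x, ENNReal.ofReal (f x) ∂μ := by
  have h := specialMeasure_preimage (μ := μ) hfm Set.univ
  rw [Set.preimage_univ, Set.univ_inter] at h
  rw [h, Measure.prod_apply (measurableSet_underGraph hfm)]
  refine lintegral_congr fun x => ?_
  have : Prod.mk x ⁻¹' {p : X × ℝ | 0 ≤ p.2 ∧ p.2 < f p.1} = Set.Ico 0 (f x) := rfl
  rw [this, Real.volume_Ico, sub_zero]

lemma isFiniteMeasure_specialMeasure [SFinite μ] (hfm : Measurable f) (hf : Integrable f μ) :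
    IsFiniteMeasure (specialMeasure μ f) := by
  refine ⟨?_⟩
  rw [specialMeasure_univ hfm]
  exact hf.lintegral_lt_top

lemma specialMeasure_univ_pos [SFinite μ] [NeZero μ] (hfm : Measurable f) (hf : ∀ x, 0 < f x) :
    specialMeasure μ f Set.univ ≠ 0 := by
  rw [specialMeasure_univ hfm, ne_eq, lintegral_eq_zero_iff hfm.ennreal_ofReal]
  intro h
  have : ∀ᵐ _ ∂μ, False := h.mono fun x hx => by
    simp [(hf x).not_ge] at hx
  exact NeZero.ne μ (ae_eq_bot.1 (eventually_false_iff_eq_bot.1 this))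

/-- The action of the integers on the suspension `X × ℝ` whose orbit space is the special space. -/
def deck (T : X ≃ᵐ X) (f : X → ℝ) (n : ℤ) (z : X × ℝ) : X × ℝ :=
  (iter T n z.1, z.2 - cocycle T f n z.1)

lemma measurePreserving_fiber_sub [SFinite μ] {u : X → ℝ} (hu : Measurable u) {g : X → X}
    (hg : MeasurePreserving g μ μ) :
    MeasurePreserving (fun z : X × ℝ => (g z.1, z.2 - u z.1)) (μ.prod volume) (μ.prod volume) :=
  hg.skew_product (g := fun x r => r - u x) (by fun_prop) <| ae_of_all _ fun x =>
    (measurePreserving_sub_right volume (u x)).map_eq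

lemma measurePreserving_deck [SFinite μ] (hT : MeasurePreserving T μ μ) (hfm : Measurable f)
    (n : ℤ) : MeasurePreserving (deck T f n) (μ.prod volume) (μ.prod volume) :=
  measurePreserving_fiber_sub (measurable_cocycle T hfm n) (measurePreserving_iter hT n)

lemma measure_eq_tsum_of_partition {Z ι : Type*} [MeasurableSpace Z] [Countable ι] {m : Measure Z}
    {P : ι → Set Z} (hP : ∀ i, MeasurableSet (P i)) (hd : Pairwise (Function.onFun Disjoint P))
    (hcover : ∀ᵐ z ∂m, ∃ i, z ∈ P i) {E : Set Z} (hE : MeasurableSet E) :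
    m E = ∑' i, m (E ∩ P i) := by
  rw [← measure_iUnion (fun i j hij => (hd hij).mono Set.inter_subset_right Set.inter_subset_right)
    fun i => hE.inter (hP i)]
  refine measure_congr_of_ae_iff ?_
  filter_upwards [hcover] with z hz
  refine ⟨fun h => ?_, fun h => ?_⟩
  · obtain ⟨i, hi⟩ := hz
    exact Set.mem_iUnion.2 ⟨i, h, hi⟩
  · obtain ⟨i, hi⟩ := Set.mem_iUnion.1 h
    exact hi.1

lemma measurable_flowFrom (hf : ∀ x, 0 < f x) (hfm : Measurable f) :
    Measurable (flowFrom T hf) := by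
  have h : Measurable fun z : X × ℝ => (⟨(z.1, 0), le_rfl, hf z.1⟩ : SpecialSpace f) :=
    Measurable.subtype_mk (by fun_prop)
  exact (measurable_specialFlow hf hfm).comp (measurable_snd.prodMk h)

lemma measurable_specialFlow_const (hf : ∀ x, 0 < f x) (hfm : Measurable f) (t : ℝ) :
    Measurable (specialFlow T f t) :=
  (measurable_specialFlow hf hfm).comp (measurable_const.prodMk measurable_id)

/-- Translates of the region under the roof along the fibres are fundamental domains for the
action by deck transformations, so they give the same measure to invariant sets. -/
lemma measure_inter_passage [SFinite μ] (hT : MeasurePreserving T μ μ) (hfm : Measurable f)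
    (hf : ∀ x, 0 < f x) (hc : ∀ᵐ x ∂μ, Complete T f x) {B : Set (SpecialSpace f)}
    (hB : MeasurableSet B) (t : ℝ) :
    μ.prod volume {z : X × ℝ | flowFrom T hf z ∈ B ∧ InPassage T f z.1 (z.2 - t) 0} =
      μ.prod volume {z : X × ℝ | flowFrom T hf z ∈ B ∧ InPassage T f z.1 z.2 0} := by
  have hBm : MeasurableSet {z : X × ℝ | flowFrom T hf z ∈ B} := measurable_flowFrom hf hfm hB
  have hPm : ∀ (s : ℝ) (n : ℤ), MeasurableSet {z : X × ℝ | InPassage T f z.1 (z.2 - s) n} :=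
    fun s n => (measurableSet_inPassage T hfm n).preimage
      (f := fun z : X × ℝ => (z.1, z.2 - s)) (by fun_prop)
  have hcz : ∀ᵐ z : X × ℝ ∂μ.prod volume, Complete T f z.1 := ae_prod_of_ae_fst hc
  have hdisj : ∀ s : ℝ, Pairwise (Function.onFun Disjoint fun n =>
      {z : X × ℝ | InPassage T f z.1 (z.2 - s) n}) := fun s i j hij =>
    Set.disjoint_left.2 fun z hi hj => hij (InPassage.unique hf hi hj)
  have hsum : ∀ (s s' : ℝ), μ.prod volume
      {z : X × ℝ | flowFrom T hf z ∈ B ∧ InPassage T f z.1 (z.2 - s) 0} =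
      ∑' n, μ.prod volume ({z : X × ℝ | flowFrom T hf z ∈ B ∧ InPassage T f z.1 (z.2 - s) 0} ∩
        {z : X × ℝ | InPassage T f z.1 (z.2 - s') n}) := fun s s' =>
    measure_eq_tsum_of_partition (hPm s') (hdisj s') (hcz.mono fun z hz => hz _)
      (hBm.inter (hPm s 0))
  have h0 := hsum t 0
  have h1 := hsum 0 t
  simp only [sub_zero] at h0 h1
  -- Each fundamental domain is cut by the translates of the other; `deck T f (-n)` matches piece
  -- `-n` of the shifted domain with piece `n` of the unshifted one, hence the sign change of the
  -- index.
  rw [h0, h1, ← (Equiv.neg ℤ).tsum_eq]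
  refine tsum_congr fun n => ?_
  have hm0 : MeasurableSet {z : X × ℝ | InPassage T f z.1 z.2 0} := by
    simpa using hPm 0 0
  have hE : MeasurableSet ({z : X × ℝ | flowFrom T hf z ∈ B ∧ InPassage T f z.1 z.2 0} ∩
      {z : X × ℝ | InPassage T f z.1 (z.2 - t) n}) := (hBm.inter hm0).inter (hPm t n)
  rw [← (measurePreserving_deck hT hfm (-n)).measure_preimage hE.nullMeasurableSet]
  refine measure_congr_of_ae_iff ?_
  filter_upwards [hcz] with z hz
  simp only [Set.mem_inter_iff, Set.mem_ofPred_eq, Set.mem_preimage, deck, flowFrom_iter hf hz,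
    Equiv.neg_apply, inPassage_iter]
  have e1 : z.2 - cocycle T f (-n) z.1 + cocycle T f (-n) z.1 = z.2 := by ring
  have e2 : z.2 - cocycle T f (-n) z.1 - t + cocycle T f (-n) z.1 = z.2 - t := by ring
  rw [e1, e2, zero_add, add_neg_cancel]
  tauto

lemma inPassage_zero_iff (x : X) (s : ℝ) : InPassage T f x s 0 ↔ 0 ≤ s ∧ s < f x := by
  simp [inPassage_iff, cocycle_zero, iter_zero]

/-- The special flow preserves the special measure. -/
lemma measurePreserving_specialFlow [SFinite μ] (hT : MeasurePreserving T μ μ)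
    (hfm : Measurable f) (hf : ∀ x, 0 < f x) (hc : ∀ᵐ x ∂μ, Complete T f x) (t : ℝ) :
    MeasurePreserving (specialFlow T f t) (specialMeasure μ f) (specialMeasure μ f) := by
  refine ⟨measurable_specialFlow_const hf hfm t, Measure.ext fun B hB => ?_⟩
  rw [Measure.map_apply (measurable_specialFlow_const hf hfm t) hB]
  have h0 : specialMeasure μ f B =
      μ.prod volume {z : X × ℝ | flowFrom T hf z ∈ B ∧ InPassage T f z.1 z.2 0} := by
    have := specialMeasure_preimage (μ := μ) hfm {z : X × ℝ | flowFrom T hf z ∈ B}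
    simp only [Set.preimage_ofPred_eq, flowFrom_coe, Set.ofPred_mem_eq] at this
    rw [this]
    simp only [inPassage_zero_iff]
    rfl
  have h1 : specialMeasure μ f (specialFlow T f t ⁻¹' B) =
      specialMeasure μ f (Subtype.val ⁻¹' {z : X × ℝ | flowFrom T hf (z.1, z.2 + t) ∈ B}) := by
    refine measure_congr_of_ae_iff ?_
    filter_upwards [ae_specialMeasure_of_ae hfm hc] with y hy
    change specialFlow T f t y ∈ B ↔ _ ∈ B
    rw [specialFlow_eq_flowFrom hf hy]
  rw [h1, h0, specialMeasure_preimage hfm, ← measure_inter_passage hT hfm hf hc hB t]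
  have hm : MeasurableSet {z : X × ℝ | flowFrom T hf z ∈ B ∧ InPassage T f z.1 (z.2 - t) 0} :=
    (measurable_flowFrom hf hfm hB).inter <| (measurableSet_inPassage T hfm 0).preimage
      (f := fun z : X × ℝ => (z.1, z.2 - t)) (by fun_prop)
  -- Translating upwards by `t` replaces the condition at height `z.2 + t` under the roof by the
  -- condition at height `z.2` under the shifted roof.
  rw [← (measurePreserving_fiber_sub (u := fun _ => -t) measurable_const
    (MeasurePreserving.id μ)).measure_preimage hm.nullMeasurableSet]
  congr 1
  ext z
  simp [inPassage_zero_iff]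

end SpecialMeasure

/-! ### Aperiodicity of the base transformation. -/

section Aperiodic

variable {X : Type*} [MeasurableSpace X]

/-- A measure without atoms on a standard Borel space takes arbitrarily small positive values. -/
lemma exists_measure_pos_lt [StandardBorelSpace X] (μ : Measure X) [IsFiniteMeasure μ] [NeZero μ]
    [NullSingletonClass μ] {ε : ENNReal} (hε : 0 < ε) :
    ∃ A, MeasurableSet A ∧ 0 < μ A ∧ μ A < ε := by
  let := upgradeStandardBorel X
  let := TopologicalSpace.upgradeIsCompletelyMetrizable X
  -- Balls around a point of the support have positive measure and shrink to a null singleton.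
  obtain ⟨x, hx⟩ := (Measure.nonempty_support (NeZero.ne μ))
  have hlim : Tendsto (fun n : ℕ => μ (Metric.ball x (1 / ((n : ℝ) + 1)))) atTop
      (𝓝 (μ (⋂ n : ℕ, Metric.ball x (1 / ((n : ℝ) + 1))))) :=
    tendsto_measure_iInter_atTop (fun n => measurableSet_ball.nullMeasurableSet)
      (fun m n hmn => Metric.ball_subset_ball (Nat.one_div_le_one_div hmn)) ⟨0, measure_ne_top _ _⟩
  have hinter : (⋂ n : ℕ, Metric.ball x (1 / ((n : ℝ) + 1))) = {x} := by
    ext y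
    simp only [Set.mem_iInter, Metric.mem_ball, Set.mem_singleton_iff]
    refine ⟨fun h => ?_, fun h n => by simpa [h] using Nat.cast_add_one_pos n⟩
    by_contra hne
    obtain ⟨n, hn⟩ := exists_nat_one_div_lt (dist_pos.2 hne)
    exact (h n).not_gt hn
  rw [hinter, measure_singleton] at hlim
  obtain ⟨n, hn⟩ := (hlim.eventually (gt_mem_nhds hε)).exists
  refine ⟨_, measurableSet_ball, ?_, hn⟩
  exact (Measure.mem_support_iff_forall x).1 hx _ (Metric.ball_mem_nhds _ Nat.one_div_pos_of_nat)

/-- An ergodic automorphism of a non-atomic standard probability space is aperiodic. -/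
lemma ae_iter_ne [StandardBorelSpace X] {μ : Measure X} [IsProbabilityMeasure μ]
    [NullSingletonClass μ] {T : X ≃ᵐ X} (hT : Ergodic T μ) :
    ∀ᵐ x ∂μ, ∀ n : ℤ, iter T n x = x → n = 0 := by
  have key : ∀ n : ℕ, ∀ᵐ x ∂μ, T^[n + 1] x ≠ x := by
    intro n
    have hm : MeasurableSet {x | T^[n + 1] x = x} :=
      measurableSet_eq_fun (T.measurable.iterate _) measurable_id
    have hinv : T ⁻¹' {x | T^[n + 1] x = x} = {x | T^[n + 1] x = x} := by
      ext x
      simp only [Set.mem_preimage, Set.mem_ofPred_eq, ← Function.iterate_succ_apply,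
        Function.iterate_succ_apply' _ (n + 1), T.injective.eq_iff]
    rcases hT.toPreErgodic.ae_empty_or_univ hm hinv with h | h
    · filter_upwards [h] with x hx hx'
      exact (cast hx hx' : x ∈ (∅ : Set X))
    exfalso
    have hper : ∀ᵐ x ∂μ, T^[n + 1] x = x := by
      filter_upwards [h] with x hx
      exact (cast hx.symm trivial : x ∈ {x | T^[n + 1] x = x})
    -- If `T^{n+1}` were almost everywhere the identity, the union of the `n + 1` preimages of a set
    -- of measure below `1/(n+1)` would be almost invariant with measure strictly between `0` and
    -- `1`.
    obtain ⟨A, hA, hA0, hA1⟩ := exists_measure_pos_lt μ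
      (ε := ((n + 1 : ℕ) : ENNReal)⁻¹) (by simp)
    let U : Set X := ⋃ i ∈ Finset.range (n + 1), T^[i] ⁻¹' A
    have hU : MeasurableSet U :=
      Finset.measurableSet_biUnion _ fun i _ => T.measurable.iterate i hA
    have hUle : μ U < 1 := by
      calc μ U ≤ ∑ i ∈ Finset.range (n + 1), μ (T^[i] ⁻¹' A) := measure_biUnion_finset_le _ _
        _ = (n + 1 : ℕ) * μ A := by
          simp [(hT.toMeasurePreserving.iterate _).measure_preimage hA.nullMeasurableSet]
        _ < (n + 1 : ℕ) * ((n + 1 : ℕ) : ENNReal)⁻¹ :=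
          ENNReal.mul_lt_mul_right (by simp) (by simp) hA1
        _ = 1 := ENNReal.mul_inv_cancel (by simp) (by simp)
    have hU0 : 0 < μ U := hA0.trans_le <| measure_mono fun x hx =>
      Set.mem_biUnion (x := 0) (by simp) (by simpa using hx)
    have hUinv : T ⁻¹' U ≤ᵐ[μ] U := by
      filter_upwards [hper] with x hx hxU
      obtain ⟨i, hi, hxi⟩ := Set.mem_iUnion₂.1 (show T x ∈ U from hxU)
      rw [Set.mem_preimage, ← Function.iterate_succ_apply] at hxi
      rcases (Finset.mem_range_succ_iff.1 hi).eq_or_lt with rfl | hlt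
      · rw [hx] at hxi
        exact Set.mem_biUnion (x := 0) (by simp) (by simpa using hxi)
      · exact Set.mem_biUnion (x := i + 1) (by simpa using hlt) hxi
    rcases hT.ae_empty_or_univ_of_preimage_ae_le hU.nullMeasurableSet hUinv with h' | h'
    · simp [measure_congr h'] at hU0
    · simp [measure_congr h'] at hUle
  filter_upwards [ae_all_iff.2 key] with x hx n hn
  by_contra h0
  obtain ⟨k, rfl | rfl⟩ := n.eq_nat_or_neg
  · obtain _ | k := k
    · simp at h0
    · exact hx k (by rw [← iter_natCast, hn])
  · obtain _ | k := k
    · simp at h0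
    · refine hx k ?_
      rw [← iter_natCast]
      conv_lhs => rw [← hn]
      rw [iter_iter_neg]

end Aperiodic

/-! ### Ergodicity makes the weak limit independent of the base point. -/

section StableConvergence

variable {X : Type*} [MeasurableSpace X] {T : X ≃ᵐ X} {f : X → ℝ} {μ : Measure X}

/-- The mean ergodic theorem, in `L¹` form for square integrable functions. -/
lemma tendsto_integral_abs_birkhoffAverage_sub [IsProbabilityMeasure μ] {S : X → X}
    (hS : Ergodic S μ) {g : X → ℝ} (hg : MemLp g 2 μ) :
    Tendsto (fun N => ∫ x, |birkhoffAverage ℝ S g N x - ∫ y, g y ∂μ| ∂μ) atTop (𝓝 0) := by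
  let U : Lp ℝ 2 μ →L[ℝ] Lp ℝ 2 μ :=
    (Lp.compMeasurePreservingₗᵢ ℝ S hS.toMeasurePreserving).toContinuousLinearMap
  let G := hg.toLp g
  have hUG : ∀ i, (U^[i] G : X → ℝ) =ᵐ[μ] fun x => g (S^[i] x) := by
    intro i
    induction i with
    | zero => exact hg.coeFn_toLp
    | succ i ih =>
      rw [Function.iterate_succ_apply']
      have h1 : (U (U^[i] G) : X → ℝ) =ᵐ[μ] (U^[i] G : X → ℝ) ∘ S :=
        Lp.coeFn_compMeasurePreserving _ hS.toMeasurePreserving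
      have h2 := hS.quasiMeasurePreserving.ae ih
      filter_upwards [h1, h2] with x hx1 hx2
      rw [hx1, Function.comp_apply, hx2, Function.iterate_succ_apply]
  have hB : ∀ N, ((birkhoffAverage ℝ U _root_.id N G : Lp ℝ 2 μ) : X → ℝ) =ᵐ[μ]
      birkhoffAverage ℝ S g N := by
    intro N
    have h1 := Lp.coeFn_smul (N : ℝ)⁻¹ (∑ i ∈ Finset.range N, U^[i] G)
    have h2 := Lp.coeFn_fun_finsetSum (Finset.range N) fun i => U^[i] G
    filter_upwards [h1, h2, ae_all_iff.2 hUG] with x hx1 hx2 hx3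
    simp only [birkhoffAverage, birkhoffSum, id_eq]
    rw [hx1, Pi.smul_apply, hx2]
    simp only [hx3]
  -- Von Neumann's theorem for the Koopman operator `U`. The limit `p` is fixed by `U`, so by
  -- ergodicity it is a constant `c`; comparing integrals then identifies `c` with `∫ g`.
  have hlim := U.tendsto_birkhoffAverage_orthogonalProjection
    (LinearIsometry.norm_toContinuousLinearMap_le _) G
  set p : Lp ℝ 2 μ := ((U.eqLocus (1 : Lp ℝ 2 μ →L[ℝ] Lp ℝ 2 μ)).orthogonalProjectionOnto G).1
    with hp
  have hpU : U p = p :=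
    ((U.eqLocus (1 : Lp ℝ 2 μ →L[ℝ] Lp ℝ 2 μ)).orthogonalProjectionOnto G).2
  have hpinv : (p : X → ℝ) ∘ S =ᵐ[μ] p := by
    have h1 : (U p : X → ℝ) =ᵐ[μ] (p : X → ℝ) ∘ S :=
      Lp.coeFn_compMeasurePreserving _ hS.toMeasurePreserving
    rw [hpU] at h1
    exact h1.symm
  obtain ⟨c, hc⟩ := hS.ae_eq_const_of_ae_eq_comp₀
    (Lp.aestronglyMeasurable p).aemeasurable.nullMeasurable hpinv
  have hgS : ∀ N, Integrable (birkhoffAverage ℝ S g N) μ := fun N =>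
    (memLp_one_iff_integrable.1 ((Lp.memLp
      (birkhoffAverage ℝ U _root_.id N G : Lp ℝ 2 μ)).mono_exponent (by norm_num))).congr (hB N)
  have hle : ∀ N, ∫ x, |birkhoffAverage ℝ S g N x - c| ∂μ ≤
      ‖birkhoffAverage ℝ U _root_.id N G - p‖ := by
    intro N
    have h1 : ∫ x, |birkhoffAverage ℝ S g N x - c| ∂μ =
        (eLpNorm (birkhoffAverage ℝ U _root_.id N G - p : Lp ℝ 2 μ) 1 μ).toReal := by
      rw [eLpNorm_one_eq_lintegral_enorm, ← integral_norm_eq_lintegral_enorm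
        (Lp.aestronglyMeasurable _)]
      refine integral_congr_ae ?_
      filter_upwards [hB N, hc, Lp.coeFn_sub (birkhoffAverage ℝ U _root_.id N G) p]
        with x h1 h2 h3
      rw [h3, Pi.sub_apply, h1, h2, Real.norm_eq_abs, Function.const_apply]
    rw [h1, Lp.norm_def]
    exact ENNReal.toReal_mono (Lp.eLpNorm_ne_top _)
      (eLpNorm_le_eLpNorm_of_exponent_le (by norm_num) (Lp.aestronglyMeasurable _))
  have h0 : Tendsto (fun N => ∫ x, |birkhoffAverage ℝ S g N x - c| ∂μ) atTop (𝓝 0) :=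
    squeeze_zero (fun N => integral_nonneg fun x => abs_nonneg _) hle
      (tendsto_iff_norm_sub_tendsto_zero.1 hlim)
  have hgi : Integrable g μ := memLp_one_iff_integrable.1 (hg.mono_exponent (by norm_num))
  have hint : ∀ N : ℕ, N ≠ 0 → ∫ x, birkhoffAverage ℝ S g N x ∂μ = ∫ y, g y ∂μ := by
    intro N hN
    have h1 : ∀ i, ∫ x, g (S^[i] x) ∂μ = ∫ y, g y ∂μ := fun i => by
      have hi := hS.toMeasurePreserving.iterate i
      conv_rhs => rw [← hi.map_eq]
      rw [integral_map hi.aemeasurable (by rw [hi.map_eq]; exact hgi.aestronglyMeasurable)]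
    simp only [birkhoffAverage, birkhoffSum, smul_eq_mul]
    rw [integral_const_mul, integral_finsetSum (f := fun i x => g (S^[i] x)) _ fun i _ =>
      (hS.toMeasurePreserving.iterate i).integrable_comp_of_integrable hgi]
    simp only [h1, Finset.sum_const, Finset.card_range, nsmul_eq_mul]
    field_simp
  have hcg : c = ∫ y, g y ∂μ := by
    have h1 : |(∫ y, g y ∂μ) - c| ≤ 0 := by
      refine ge_of_tendsto h0 ((eventually_ne_atTop 0).mono fun N hN => ?_)
      rw [← hint N hN]
      calc |∫ x, birkhoffAverage ℝ S g N x ∂μ - c|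
          = |∫ x, (birkhoffAverage ℝ S g N x - c) ∂μ| := by
            rw [integral_sub (hgS N) (integrable_const _)]
            simp
        _ ≤ _ := abs_integral_le_integral_abs
    have := abs_nonpos_iff.1 h1
    linarith
  rwa [hcg] at h0

/-- Bounded functions that are asymptotically invariant under an ergodic transformation are
asymptotically uncorrelated with every bounded function. -/
lemma tendsto_integral_mul_sub_of_almost_invariant [IsProbabilityMeasure μ] {S : X → X}
    (hS : Ergodic S μ) {h : ℕ → X → ℝ} (hm : ∀ n, Measurable (h n)) {C : ℝ}
    (hC : ∀ n x, |h n x| ≤ C)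
    (hinv : Tendsto (fun n => ∫ x, |h n (S x) - h n x| ∂μ) atTop (𝓝 0))
    {g : X → ℝ} (hg : Measurable g) {K : ℝ} (hK : ∀ x, |g x| ≤ K) :
    Tendsto (fun n => ∫ x, g x * h n x ∂μ - (∫ x, g x ∂μ) * ∫ x, h n x ∂μ) atTop (𝓝 0) := by
  have hSm := hS.toMeasurePreserving.measurable
  have bint : ∀ {k : X → ℝ} {D : ℝ}, Measurable k → (∀ x, |k x| ≤ D) → Integrable k μ :=
    fun hk hD => Integrable.of_bound hk.aestronglyMeasurable _ (ae_of_all _ hD)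
  have hgi : ∀ i, Measurable fun x => g (S^[i] x) := fun i => hg.comp (hSm.iterate i)
  have hC0 : 0 ≤ C := (abs_nonneg _).trans (hC 0 (Classical.choice (μ.nonempty_of_neZero)))
  have hmul : ∀ {k l : X → ℝ} {D E : ℝ}, Measurable k → (∀ x, |k x| ≤ D) → Measurable l →
      (∀ x, |l x| ≤ E) → Integrable (fun x => k x * l x) μ := fun hk hD hl hE =>
    bint (D := _ * _) (hk.mul hl) fun x => by
      rw [abs_mul]
      exact mul_le_mul (hD x) (hE x) (abs_nonneg _) ((abs_nonneg _).trans (hD x))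
  have hcomp : ∀ {k : X → ℝ}, Measurable k → ∫ x, k (S x) ∂μ = ∫ x, k x ∂μ := fun {k} hk => by
    conv_rhs => rw [← hS.toMeasurePreserving.map_eq]
    rw [integral_map hSm.aemeasurable hk.aestronglyMeasurable]
  -- composing the test function with `S` does not change the limit
  have hstep : ∀ i, Tendsto (fun n => ∫ x, g (S^[i] x) * h n x ∂μ - ∫ x, g x * h n x ∂μ)
      atTop (𝓝 0) := by
    intro i
    induction i with
    | zero => simp
    | succ i ih =>
      have hd : Tendsto (fun n => ∫ x, g (S^[i + 1] x) * h n x ∂μ -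
          ∫ x, g (S^[i] x) * h n x ∂μ) atTop (𝓝 0) := by
        refine squeeze_zero_norm (fun n => ?_) (by simpa using hinv.const_mul K)
        have h1 : ∫ x, g (S^[i] x) * h n x ∂μ = ∫ x, g (S^[i + 1] x) * h n (S x) ∂μ := by
          simp only [Function.iterate_succ_apply]
          exact (hcomp (k := fun x => g (S^[i] x) * h n x) ((hgi i).mul (hm n))).symm
        rw [h1, ← integral_sub (hmul (hgi _) (fun x => hK _) (hm n) (hC n))
          (hmul (l := fun x => h n (S x)) (hgi _) (fun x => hK _) ((hm n).comp hSm)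
            (fun x => hC n _)),
          ← integral_const_mul]
        refine norm_integral_le_of_norm_le ((bint (D := 2 * C) (by
          exact (((hm n).comp hSm).sub (hm n)).abs) fun x => ?_).const_mul K)
          (ae_of_all _ fun x => ?_)
        · rw [abs_abs]
          have := abs_sub (h n (S x)) (h n x)
          linarith [hC n x, hC n (S x)]
        · rw [← mul_sub, norm_mul, Real.norm_eq_abs, Real.norm_eq_abs, abs_sub_comm (h n x)]
          exact mul_le_mul_of_nonneg_right (hK _) (abs_nonneg _)
      simpa using hd.add ih
  have havg : ∀ N : ℕ, N ≠ 0 → Tendsto (fun n => ∫ x, birkhoffAverage ℝ S g N x * h n x ∂μ -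
      ∫ x, g x * h n x ∂μ) atTop (𝓝 0) := by
    intro N hN
    have h1 := (tendsto_finsetSum (Finset.range N) fun i _ => hstep i).const_mul (N : ℝ)⁻¹
    simp only [Finset.sum_const_zero, mul_zero] at h1
    refine h1.congr fun n => ?_
    have h2 : ∀ x, birkhoffAverage ℝ S g N x * h n x =
        (N : ℝ)⁻¹ * ∑ i ∈ Finset.range N, g (S^[i] x) * h n x := fun x => by
      simp only [birkhoffAverage, birkhoffSum, smul_eq_mul, ← Finset.sum_mul, mul_assoc]
    simp only [h2]
    rw [integral_const_mul, integral_finsetSum _ fun i _ =>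
      hmul (hgi i) (fun x => hK _) (hm n) (hC n), Finset.sum_sub_distrib, mul_sub]
    simp only [Finset.sum_const, Finset.card_range, nsmul_eq_mul]
    field_simp
  have hgLp : MemLp g 2 μ := MemLp.of_bound hg.aestronglyMeasurable K (ae_of_all _ hK)
  have hBm : ∀ N, Measurable (birkhoffAverage ℝ S g N) := fun N =>
    (Finset.measurable_fun_sum (Finset.range N) fun i _ => hgi i).const_smul (N : ℝ)⁻¹
  have hBb : ∀ N : ℕ, ∃ D, ∀ x, |birkhoffAverage ℝ S g N x| ≤ D := fun N =>
    ⟨(N : ℝ)⁻¹ * ∑ i ∈ Finset.range N, K, fun x => by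
      simp only [birkhoffAverage, birkhoffSum, smul_eq_mul]
      rw [abs_mul, abs_of_nonneg (by positivity : (0 : ℝ) ≤ (N : ℝ)⁻¹)]
      exact mul_le_mul_of_nonneg_left ((Finset.abs_sum_le_sum_abs _ _).trans
        (Finset.sum_le_sum fun i _ => hK _)) (by positivity)⟩
  rw [Metric.tendsto_atTop]
  intro ε hε
  -- First fix `N` so that the average of `g` is close to its mean in `L¹`, then let `n` grow. The
  -- denominator has `C + 1` since `C` may be zero.
  have hmean := (tendsto_integral_abs_birkhoffAverage_sub hS hgLp).eventually
    (gt_mem_nhds (show 0 < ε / (2 * (C + 1)) by positivity))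
  obtain ⟨N, hN1, hN0⟩ := (hmean.and (eventually_ne_atTop 0)).exists
  obtain ⟨n0, hn0⟩ := Metric.tendsto_atTop.1 (havg N hN0) (ε / 2) (by positivity)
  refine ⟨n0, fun n hn => ?_⟩
  have h1 := hn0 n hn
  obtain ⟨D, hD⟩ := hBb N
  have h2 : |∫ x, birkhoffAverage ℝ S g N x * h n x ∂μ - (∫ x, g x ∂μ) * ∫ x, h n x ∂μ| ≤
      C * ∫ x, |birkhoffAverage ℝ S g N x - ∫ y, g y ∂μ| ∂μ := by
    rw [← integral_const_mul, ← integral_sub (hmul (hBm N) hD (hm n) (hC n))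
      ((bint (hm n) (hC n)).const_mul _), ← integral_const_mul, ← Real.norm_eq_abs]
    refine norm_integral_le_of_norm_le
      ((((bint (hBm N) hD).sub (integrable_const _)).abs).const_mul C) (ae_of_all _ fun x => ?_)
    rw [← sub_mul, norm_mul, mul_comm]
    exact mul_le_mul_of_nonneg_right (hC n x) (abs_nonneg _)
  have h3 : C * ∫ x, |birkhoffAverage ℝ S g N x - ∫ y, g y ∂μ| ∂μ ≤ ε / 2 := by
    calc _ ≤ (C + 1) * (ε / (2 * (C + 1))) :=
          mul_le_mul (by linarith) hN1.le (integral_nonneg fun x => abs_nonneg _) (by linarith)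
      _ = ε / 2 := by field_simp
  rw [Real.dist_eq, sub_zero] at h1 ⊢
  rw [abs_lt] at h1 ⊢
  have h4 := abs_le.1 (h2.trans h3)
  constructor <;> linarith [h1.1, h1.2, h4.1, h4.2]

/-- A layer-cake formula for differences: with Fubini it reduces the `L¹` distance of two functions
to symmetric differences of their superlevel sets, which is what rigidity controls. -/
lemma volume_setOf_not_lt_iff_lt (a b : ℝ) :
    volume {s : ℝ | ¬ (s < a ↔ s < b)} = ENNReal.ofReal |a - b| := by
  have : {s : ℝ | ¬ (s < a ↔ s < b)} = Set.Ico (min a b) (max a b) := by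
    ext s
    simp only [Set.mem_ofPred_eq, Set.mem_Ico, min_le_iff, lt_max_iff]
    rcases lt_or_ge s a with h1 | h1 <;> rcases lt_or_ge s b with h2 | h2 <;>
      simp [h1, h2, not_lt.2, not_le.2]
  rw [this, Real.volume_Ico, max_sub_min_eq_abs']

/-- If `S n` is asymptotically the identity on the sets `W n`, then so is its action on an
integrable function. -/
lemma tendsto_setIntegral_abs_comp_sub [IsFiniteMeasure μ] {S : ℕ → X → X}
    (hS : ∀ n, MeasurePreserving (S n) μ μ) {W : ℕ → Set X}
    (hrigid : ∀ A, MeasurableSet A →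
      Tendsto (fun n => μ (((S n ⁻¹' A) ∆ A) ∩ W n)) atTop (𝓝 0))
    (hfm : Measurable f) (hf : ∀ x, 0 < f x) (hfi : Integrable f μ) :
    Tendsto (fun n => ∫ x in W n, |f (S n x) - f x| ∂μ) atTop (𝓝 0) := by
  have hA : ∀ s : ℝ, MeasurableSet {x | s < f x} := fun s => measurableSet_lt measurable_const hfm
  have hD : ∀ n, MeasurableSet {z : X × ℝ | ¬ (z.2 < f (S n z.1) ↔ z.2 < f z.1)} := fun n =>
    ((measurableSet_lt measurable_snd (hfm.comp ((hS n).measurable.comp measurable_fst))).iff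
      (measurableSet_lt measurable_snd (hfm.comp measurable_fst))).compl
  have hslice : ∀ n (s : ℝ), μ.restrict (W n) ((fun x => (x, s)) ⁻¹'
      {z : X × ℝ | ¬ (z.2 < f (S n z.1) ↔ z.2 < f z.1)}) =
      μ (((S n ⁻¹' {x | s < f x}) ∆ {x | s < f x}) ∩ W n) := fun n s => by
    rw [Measure.restrict_apply (measurable_prodMk_right (hD n))]
    congr 2
    ext x
    simp only [Set.mem_preimage, Set.mem_ofPred_eq, Set.mem_symmDiff]
    tauto
  have key : ∀ n, ∫⁻ x in W n, ENNReal.ofReal |f (S n x) - f x| ∂μ =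
      ∫⁻ s : ℝ, μ (((S n ⁻¹' {x | s < f x}) ∆ {x | s < f x}) ∩ W n) := by
    intro n
    calc ∫⁻ x in W n, ENNReal.ofReal |f (S n x) - f x| ∂μ
        = ((μ.restrict (W n)).prod volume)
          {z : X × ℝ | ¬ (z.2 < f (S n z.1) ↔ z.2 < f z.1)} := by
          rw [Measure.prod_apply (hD n)]
          exact lintegral_congr fun x => (volume_setOf_not_lt_iff_lt _ _).symm
      _ = _ := by
          rw [Measure.prod_apply_symm (hD n)]
          exact lintegral_congr fun s => hslice n s
  have hlim : Tendsto (fun n => ∫⁻ x in W n, ENNReal.ofReal |f (S n x) - f x| ∂μ) atTop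
      (𝓝 0) := by
    simp only [key]
    rw [← lintegral_zero (μ := (volume : Measure ℝ))]
    refine tendsto_lintegral_of_dominated_convergence
      -- The dominating function has integral `2 ∫ f`. Levels `s ≤ 0` contribute nothing, because `f
      -- > 0` makes the superlevel set all of `X`.
      ((Set.Ioi 0).indicator fun s => 2 * μ {x | s < f x}) (fun n => ?_) (fun n => ?_) ?_
      (ae_of_all _ fun s => hrigid _ (hA s))
    · simpa only [hslice] using measurable_measure_prodMk_right (μ := μ.restrict (W n)) (hD n)
    · have h0 : ∀ᵐ s : ℝ, s ≠ 0 := by simp [ae_iff]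
      filter_upwards [h0] with s hs
      by_cases hs0 : 0 < s
      · rw [Set.indicator_of_mem (Set.mem_Ioi.2 hs0), two_mul]
        calc _ ≤ μ ((S n ⁻¹' {x | s < f x}) ∪ {x | s < f x}) :=
              measure_mono fun x hx => hx.1.imp And.left And.left
          _ ≤ _ := measure_union_le _ _
          _ = _ := by rw [(hS n).measure_preimage (hA s).nullMeasurableSet]
      · have : {x | s < f x} = Set.univ :=
          Set.eq_univ_of_forall fun x => (not_lt.1 hs0).trans_lt (hf x)
        simp [this]
    · rw [lintegral_indicator measurableSet_Ioi, lintegral_const_mul' _ _ (by simp),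
        ← lintegral_eq_lintegral_meas_lt μ (ae_of_all _ fun x => (hf x).le) hfm.aemeasurable]
      exact ENNReal.mul_ne_top (by simp) hfi.lintegral_lt_top.ne
  have := (ENNReal.tendsto_toReal ENNReal.zero_ne_top).comp hlim
  refine this.congr fun n => ?_
  rw [Function.comp_apply, integral_eq_lintegral_of_nonneg_ae (ae_of_all _ fun x => abs_nonneg _)
    (Measurable.aestronglyMeasurable (by exact ((hfm.comp (hS n).measurable).sub hfm).abs))]

/-- The increments of the normalized Birkhoff sums along `T` vanish asymptotically, so functions of
them, restricted to almost invariant sets, are almost invariant. -/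
lemma tendsto_integral_abs_indicator_comp_sub [IsProbabilityMeasure μ]
    (hT : MeasurePreserving T μ μ) (hfi : Integrable f μ)
    {W : ℕ → Set X} (hW : ∀ n, MeasurableSet (W n))
    (hWinv : Tendsto (fun n => μ (W n ∆ (T ⁻¹' W n))) atTop (𝓝 0))
    {Θ : ℝ × ℝ → ℝ} {C L : ℝ} (hC : ∀ p, |Θ p| ≤ C) (hL0 : 0 ≤ L)
    (hL : ∀ p p', |Θ p - Θ p'| ≤ L * (|p.1 - p'.1| + |p.2 - p'.2|))
    {q q' : ℕ → ℕ} (a a' : ℕ → ℝ)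
    (hq : Tendsto (fun n => ∫ x in W n, |f (iter T (q n) x) - f x| ∂μ) atTop (𝓝 0))
    (hq' : Tendsto (fun n => ∫ x in W n, |f (iter T (q' n) x) - f x| ∂μ) atTop (𝓝 0)) :
    Tendsto (fun n => ∫ x,
      |(W n).indicator (fun x => Θ (cocycle T f (q' n) x - a' n, cocycle T f (q n) x - a n)) (T x) -
        (W n).indicator (fun x => Θ (cocycle T f (q' n) x - a' n, cocycle T f (q n) x - a n)) x| ∂μ)
      atTop (𝓝 0) := by
  have hint : ∀ k : ℕ, Integrable (fun x => |f (iter T k x) - f x|) μ := fun k =>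
    (((measurePreserving_iter hT k).integrable_comp_of_integrable hfi).sub hfi).abs
  have hD : ∀ n, MeasurableSet (W n ∆ (T ⁻¹' W n)) := fun n =>
    (hW n).symmDiff (T.measurable (hW n))
  have hcoc : ∀ (k : ℕ) x, cocycle T f k (T x) - cocycle T f k x = f (iter T k x) - f x := by
    intro k x
    have h1 := cocycle_add (T := T) (f := f) k 1 x
    rw [cocycle_succ, cocycle_one, iter_one] at h1
    linarith
  -- If exactly one of `x`, `T x` is in `W n`, the difference is at most `C`; if both are, the
  -- Lipschitz bound and the telescoped identity `hcoc` apply.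
  refine squeeze_zero (g := fun n => C * μ.real (W n ∆ (T ⁻¹' W n)) +
    (L * ∫ x in W n, |f (iter T (q' n) x) - f x| ∂μ +
      L * ∫ x in W n, |f (iter T (q n) x) - f x| ∂μ))
    (fun n => integral_nonneg fun x => abs_nonneg _) (fun n => ?_) ?_
  · have hi1 : Integrable ((W n ∆ (T ⁻¹' W n)).indicator fun _ => C) μ :=
      (integrable_const C).indicator (hD n)
    have hi2 : Integrable ((W n).indicator fun x => L * |f (iter T (q' n) x) - f x|) μ :=
      ((hint _).const_mul L).indicator (hW n)
    have hi3 : Integrable ((W n).indicator fun x => L * |f (iter T (q n) x) - f x|) μ :=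
      ((hint _).const_mul L).indicator (hW n)
    have hsum : C * μ.real (W n ∆ (T ⁻¹' W n)) +
        (L * ∫ x in W n, |f (iter T (q' n) x) - f x| ∂μ +
          L * ∫ x in W n, |f (iter T (q n) x) - f x| ∂μ) =
        ∫ x, ((W n ∆ (T ⁻¹' W n)).indicator (fun _ => C) x +
          ((W n).indicator (fun x => L * |f (iter T (q' n) x) - f x|) x +
            (W n).indicator (fun x => L * |f (iter T (q n) x) - f x|) x)) ∂μ := by
      rw [integral_add hi1 (by exact hi2.add hi3), integral_add hi2 hi3,
        integral_indicator (hD n), integral_indicator (hW n), integral_indicator (hW n),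
        integral_const_mul, integral_const_mul, setIntegral_const, smul_eq_mul, mul_comm C]
    rw [hsum]
    refine integral_mono_of_nonneg (ae_of_all _ fun x => abs_nonneg _)
      (hi1.add (hi2.add hi3)) (ae_of_all _ fun x => ?_)
    have hmem : x ∈ W n ∆ (T ⁻¹' W n) ↔ x ∈ W n ∧ T x ∉ W n ∨ T x ∈ W n ∧ x ∉ W n :=
      Set.mem_symmDiff
    beta_reduce
    by_cases h1 : x ∈ W n <;> by_cases h2 : T x ∈ W n
    · rw [Set.indicator_of_mem h1, Set.indicator_of_mem h2, Set.indicator_of_mem h1,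
        Set.indicator_of_mem h1, Set.indicator_of_notMem (by tauto), zero_add, ← mul_add]
      refine (hL _ _).trans_eq ?_
      simp only [sub_sub_sub_cancel_right, hcoc]
    · rw [Set.indicator_of_mem h1, Set.indicator_of_notMem h2, Set.indicator_of_mem h1,
        Set.indicator_of_mem h1, Set.indicator_of_mem (by tauto), zero_sub, abs_neg]
      exact (hC _).trans (le_add_of_nonneg_right (by positivity))
    · rw [Set.indicator_of_notMem h1, Set.indicator_of_mem h2, Set.indicator_of_notMem h1,
        Set.indicator_of_notMem h1, Set.indicator_of_mem (by tauto), sub_zero, add_zero, add_zero]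
      exact hC _
    · rw [Set.indicator_of_notMem h1, Set.indicator_of_notMem h2, Set.indicator_of_notMem h1,
        Set.indicator_of_notMem h1, Set.indicator_of_notMem (by tauto)]
      simp
  · have h1 := (ENNReal.tendsto_toReal ENNReal.zero_ne_top).comp hWinv
    simpa [Measure.real] using (h1.const_mul C).add ((hq'.const_mul L).add (hq.const_mul L))

/-- The joint distribution of the normalized Birkhoff sums on `W n` converges stably: the limit is
the same on each measurable subset. -/
lemma tendsto_setIntegral_of_partialRigidity [IsProbabilityMeasure μ] (hT : Ergodic T μ)
    (hfm : Measurable f) (hf : ∀ x, 0 < f x) (hfi : Integrable f μ)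
    {W : ℕ → Set X} (hW : ∀ n, MeasurableSet (W n)) {q q' : ℕ → ℕ} {a a' : ℕ → ℝ} {α : ℝ}
    {P : Measure (ℝ × ℝ)} (h : PartialRigidityConditions μ T f W q q' a a' α P)
    (Θ : (ℝ × ℝ) →ᵇ ℝ) {L : ℝ} (hL0 : 0 ≤ L)
    (hL : ∀ p p', |Θ p - Θ p'| ≤ L * (|p.1 - p'.1| + |p.2 - p'.2|))
    {A : Set X} (hA : MeasurableSet A) :
    Tendsto (fun n => ∫ x in A ∩ W n,
      Θ (cocycle T f (q' n) x - a' n, cocycle T f (q n) x - a n) ∂μ) atTop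
      (𝓝 (μ.real A * (α * ∫ p, Θ p ∂P))) := by
  have hrig : ∀ {r : ℕ → ℕ}, IsRigiditySequenceAlong μ T r W →
      Tendsto (fun n => ∫ x in W n, |f (iter T (r n) x) - f x| ∂μ) atTop (𝓝 0) := fun hr =>
    tendsto_setIntegral_abs_comp_sub
      (fun n => measurePreserving_iter hT.toMeasurePreserving _) hr.2 hfm hf hfi
  have hFm : ∀ n, Measurable fun x =>
      (cocycle T f (q' n) x - a' n, cocycle T f (q n) x - a n) := fun n =>
    ((measurable_cocycle T hfm _).sub_const _).prodMk ((measurable_cocycle T hfm _).sub_const _)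
  have hΘm : Measurable Θ := Θ.continuous.measurable
  have hinv := tendsto_integral_abs_indicator_comp_sub hT.toMeasurePreserving hfi hW
    h.almost_invariant (fun p => Θ.norm_coe_le_norm p) hL0 hL a a' (hrig h.rigid)
    (hrig h.rigid')
  -- Decorrelation from the indicator of `A` reduces the claim to `A = X`, where it is the assumed
  -- weak convergence times `μ(W n) → α`.
  have hdecor := tendsto_integral_mul_sub_of_almost_invariant hT
    (h := fun n => (W n).indicator fun x =>
      Θ (cocycle T f (q' n) x - a' n, cocycle T f (q n) x - a n))
    (fun n => (hΘm.comp (hFm n)).indicator (hW n)) (C := ‖Θ‖)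
    (fun n x => by
      rw [← Real.norm_eq_abs]
      exact (norm_indicator_le_norm_self _ _).trans (Θ.norm_coe_le_norm _)) hinv
    (g := A.indicator fun _ => 1) (measurable_const.indicator hA) (K := 1)
    (fun x => by by_cases hx : x ∈ A <;> simp [hx])
  have hmean : Tendsto (fun n => ∫ x, (W n).indicator (fun x =>
      Θ (cocycle T f (q' n) x - a' n, cocycle T f (q n) x - a n)) x ∂μ) atTop
      (𝓝 (α * ∫ p, Θ p ∂P)) := by
    refine (h.tendsto_measure.mul (h.weak_limit Θ)).congr fun n => ?_
    rw [integral_indicator (hW n), integral_map (hFm n).aemeasurable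
      hΘm.aestronglyMeasurable, ProbabilityTheory.cond, integral_smul_measure, smul_eq_mul,
      ← mul_assoc]
    by_cases h0 : μ (W n) = 0
    · simp [Measure.real, h0, Measure.restrict_eq_zero.2 h0]
    · rw [Measure.real, ENNReal.toReal_inv, mul_inv_cancel₀
        (ENNReal.toReal_ne_zero.2 ⟨h0, measure_ne_top _ _⟩), one_mul]
  have hA1 : ∫ x, A.indicator (fun _ => (1 : ℝ)) x ∂μ = μ.real A := by
    rw [integral_indicator hA]
    simp
  have hfin := hdecor.add (hmean.const_mul (μ.real A))
  rw [zero_add] at hfin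
  refine hfin.congr fun n => ?_
  rw [hA1, sub_add_cancel, ← integral_indicator (hA.inter (hW n))]
  refine integral_congr_ae (ae_of_all _ fun x => ?_)
  by_cases h1 : x ∈ A <;> by_cases h2 : x ∈ W n <;> simp [h1, h2]

end StableConvergence

/-! ### Convergence of laws of triples on a fibre of the suspension. -/

section TripleConvergence

/-- Setwise convergence of measures dominated by a fixed finite measure can be tested on a
generating π-system. -/
lemma tendsto_measure_of_isPiSystem {Z : Type*} [mZ : MeasurableSpace Z] {m : Measure Z}
    [IsFiniteMeasure m] {ρ : ℕ → Measure Z} {σ : Measure Z} (hρ : ∀ n, ρ n ≤ m) (hσ : σ ≤ m)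
    {C : Set (Set Z)} (hgen : mZ = MeasurableSpace.generateFrom C) (hpi : IsPiSystem C)
    {K : Set Z} (hK : K ∈ C) (hKm : m Kᶜ = 0)
    (hC : ∀ s ∈ C, Tendsto (fun n => ρ n s) atTop (𝓝 (σ s))) {s : Set Z} (hs : MeasurableSet s) :
    Tendsto (fun n => ρ n s) atTop (𝓝 (σ s)) := by
  have hfin : ∀ n, IsFiniteMeasure (ρ n) := fun n => isFiniteMeasure_of_le m (hρ n)
  have hfinσ : IsFiniteMeasure σ := isFiniteMeasure_of_le m hσ
  -- Complements require convergence of total masses; the whole space need not belong to `C`, so the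
  -- full-measure set `K` replaces it.
  have huniv : ∀ ν : Measure Z, ν ≤ m → ν Set.univ = ν K := fun ν hν =>
    (measure_congr_of_ae_iff ((show ∀ᵐ z ∂ν, z ∈ K from
      le_antisymm ((hν _).trans_eq hKm) zero_le).mono fun z hz => by simp [hz])).symm
  induction s, hs using MeasurableSpace.induction_on_inter hgen hpi with
  | empty => simp
  | basic t ht => exact hC t ht
  | compl t ht ih =>
    have h1 : ∀ ν : Measure Z, IsFiniteMeasure ν → ν ≤ m → ν tᶜ = ν K - ν t := fun ν _ hν => by
      rw [measure_compl ht (measure_ne_top _ _), huniv ν hν]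
    rw [h1 σ hfinσ hσ]
    simp only [fun n => h1 (ρ n) (hfin n) (hρ n)]
    exact ENNReal.Tendsto.sub (hC K hK) ih (Or.inl (measure_ne_top _ _))
  | iUnion g hd hg ih =>
    simp only [measure_iUnion hd hg]
    -- A sum over the disjoint pieces is an integral for counting measure, dominated by the summable
    -- `m (g i)`; this is where domination by one finite measure is essential.
    simp only [← lintegral_count]
    refine tendsto_lintegral_of_dominated_convergence (fun i => m (g i))
      (fun n => measurable_from_top) (fun n => ae_of_all _ fun i => hρ n _) ?_ (ae_of_all _ ih)
    rw [lintegral_count, ← measure_iUnion hd hg]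
    exact measure_ne_top _ _

lemma map_restrict_fst_apply {Y Z : Type*} [MeasurableSpace Y] [MeasurableSpace Z]
    (κ : Measure Y) {g : Y → Z} (hg : Measurable g) (E : Set Y) {A : Set Z}
    (hA : MeasurableSet A) : ((κ.restrict E).map g) A = κ (g ⁻¹' A ∩ E) := by
  rw [Measure.map_apply hg hA, Measure.restrict_apply (hg hA)]

/-- Measures on a triple product with dominated marginals: convergence on products of sets of a
π-system implies convergence on all measurable boxes. -/
lemma tendsto_measure_prod_prod_of_isPiSystem {Z : Type*} [mZ : MeasurableSpace Z] {m : Measure Z}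
    [IsFiniteMeasure m] {κ : ℕ → Measure (Z × Z × Z)} {σ : Measure (Z × Z × Z)}
    (hκ1 : ∀ n, (κ n).map (fun y => y.1) ≤ m) (hκ2 : ∀ n, (κ n).map (fun y => y.2.1) ≤ m)
    (hκ3 : ∀ n, (κ n).map (fun y => y.2.2) ≤ m)
    (hσ1 : σ.map (fun y => y.1) ≤ m) (hσ2 : σ.map (fun y => y.2.1) ≤ m)
    (hσ3 : σ.map (fun y => y.2.2) ≤ m)
    {𝒞 : Set (Set Z)} (hgen : mZ = MeasurableSpace.generateFrom 𝒞) (hpi : IsPiSystem 𝒞)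
    {K : Set Z} (hK : K ∈ 𝒞) (hKm : m Kᶜ = 0)
    (hbox : ∀ A ∈ 𝒞, ∀ B ∈ 𝒞, ∀ C ∈ 𝒞,
      Tendsto (fun n => κ n (A ×ˢ B ×ˢ C)) atTop (𝓝 (σ (A ×ˢ B ×ˢ C))))
    {A B C : Set Z} (hA : MeasurableSet A) (hB : MeasurableSet B) (hC : MeasurableSet C) :
    Tendsto (fun n => κ n (A ×ˢ B ×ˢ C)) atTop (𝓝 (σ (A ×ˢ B ×ˢ C))) := by
  have hmeas : ∀ S ∈ 𝒞, MeasurableSet S := fun S hS =>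
    hgen ▸ MeasurableSpace.measurableSet_generateFrom hS
  -- One coordinate is upgraded at a time: `E` holds the other two factors fixed, leaving measures
  -- on `Z` dominated by `m`.
  have key : ∀ (g : Z × Z × Z → Z), Measurable g → (∀ n, (κ n).map g ≤ m) → σ.map g ≤ m →
      ∀ (E : Set (Z × Z × Z)), (∀ S ∈ 𝒞, Tendsto (fun n => κ n (g ⁻¹' S ∩ E)) atTop
        (𝓝 (σ (g ⁻¹' S ∩ E)))) → ∀ {S : Set Z}, MeasurableSet S →
      Tendsto (fun n => κ n (g ⁻¹' S ∩ E)) atTop (𝓝 (σ (g ⁻¹' S ∩ E))) := by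
    intro g hg h1 h2 E h3 S hS
    have h4 : ∀ ν : Measure (Z × Z × Z), (ν.restrict E).map g ≤ ν.map g := fun ν =>
      Measure.map_mono Measure.restrict_le_self hg
    have := tendsto_measure_of_isPiSystem (ρ := fun n => ((κ n).restrict E).map g)
      (σ := (σ.restrict E).map g) (fun n => (h4 _).trans (h1 n)) ((h4 _).trans h2) hgen hpi hK hKm
      (fun S hS => by
        simpa only [map_restrict_fst_apply _ hg E (hmeas S hS)] using h3 S hS) hS
    simpa only [map_restrict_fst_apply _ hg E hS] using this
  have e1 : ∀ A B C : Set Z, (fun y : Z × Z × Z => y.1) ⁻¹' A ∩ (Set.univ ×ˢ B ×ˢ C) =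
      A ×ˢ B ×ˢ C := fun A B C => by ext; simp
  have e2 : ∀ A B C : Set Z, (fun y : Z × Z × Z => y.2.1) ⁻¹' B ∩ (A ×ˢ Set.univ ×ˢ C) =
      A ×ˢ B ×ˢ C := fun A B C => by ext; simp; tauto
  have e3 : ∀ A B C : Set Z, (fun y : Z × Z × Z => y.2.2) ⁻¹' C ∩ (A ×ˢ B ×ˢ Set.univ) =
      A ×ˢ B ×ˢ C := fun A B C => by ext; simp; tauto
  have s1 : ∀ B ∈ 𝒞, ∀ C ∈ 𝒞, Tendsto (fun n => κ n (A ×ˢ B ×ˢ C)) atTop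
      (𝓝 (σ (A ×ˢ B ×ˢ C))) := fun B hB C hC => by
    simpa only [e1] using key (fun y => y.1) (by fun_prop) hκ1 hσ1 (Set.univ ×ˢ B ×ˢ C)
      (fun S hS => by simpa only [e1] using hbox S hS B hB C hC) hA
  have s2 : ∀ C ∈ 𝒞, Tendsto (fun n => κ n (A ×ˢ B ×ˢ C)) atTop
      (𝓝 (σ (A ×ˢ B ×ˢ C))) := fun C hC => by
    simpa only [e2] using key (fun y => y.2.1) (by fun_prop) hκ2 hσ2 (A ×ˢ Set.univ ×ˢ C)
      (fun S hS => by simpa only [e2] using s1 S hS C hC) hB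
  simpa only [e3] using key (fun y => y.2.2) (by fun_prop) hκ3 hσ3 (A ×ˢ B ×ˢ Set.univ)
    (fun S hS => by simpa only [e3] using s2 S hS) hC

/-- The length of `(l 0, r 0] ∩ ((l 1, r 1] + p.1) ∩ ((l 2, r 2] + p.2)`. -/
def overlap (l r : Fin 3 → ℝ) (p : ℝ × ℝ) : ℝ :=
  max 0 (min (min (r 0) (r 1 + p.1)) (r 2 + p.2) - max (max (l 0) (l 1 + p.1)) (l 2 + p.2))

lemma volume_inter_translates (l r : Fin 3 → ℝ) (p : ℝ × ℝ) :
    volume {s : ℝ | s ∈ Set.Ioc (l 0) (r 0) ∧ s - p.1 ∈ Set.Ioc (l 1) (r 1) ∧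
      s - p.2 ∈ Set.Ioc (l 2) (r 2)} = ENNReal.ofReal (overlap l r p) := by
  have : {s : ℝ | s ∈ Set.Ioc (l 0) (r 0) ∧ s - p.1 ∈ Set.Ioc (l 1) (r 1) ∧
      s - p.2 ∈ Set.Ioc (l 2) (r 2)} = Set.Ioc (max (max (l 0) (l 1 + p.1)) (l 2 + p.2))
        (min (min (r 0) (r 1 + p.1)) (r 2 + p.2)) := by
    ext s
    simp only [Set.mem_ofPred_eq, Set.mem_Ioc, max_lt_iff, le_min_iff, lt_sub_iff_add_lt,
      sub_le_iff_le_add]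
    tauto
  rw [this, Real.volume_Ioc, overlap]
  rcases le_total 0 (min (min (r 0) (r 1 + p.1)) (r 2 + p.2) -
    max (max (l 0) (l 1 + p.1)) (l 2 + p.2)) with h | h
  · rw [max_eq_right h]
  · rw [max_eq_left h, ENNReal.ofReal_of_nonpos h, ENNReal.ofReal_zero]

lemma overlap_nonneg (l r : Fin 3 → ℝ) (p : ℝ × ℝ) : 0 ≤ overlap l r p := le_max_left _ _

lemma overlap_le (l r : Fin 3 → ℝ) (p : ℝ × ℝ) : overlap l r p ≤ |r 0 - l 0| := by
  refine max_le (abs_nonneg _) (le_trans ?_ (le_abs_self _))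
  exact sub_le_sub ((min_le_left _ _).trans (min_le_left _ _))
    ((le_max_left _ _).trans (le_max_left _ _))

/-- Nested minima and maxima are 1-Lipschitz for the sup norm; the factor `2` counts the upper and
the lower endpoint. -/
lemma abs_overlap_sub_le (l r : Fin 3 → ℝ) (p p' : ℝ × ℝ) :
    |overlap l r p - overlap l r p'| ≤ 2 * (|p.1 - p'.1| + |p.2 - p'.2|) := by
  have hmin := (abs_min_sub_min_le_max (min (r 0) (r 1 + p.1)) (r 2 + p.2)
    (min (r 0) (r 1 + p'.1)) (r 2 + p'.2)).trans
      (max_le_max_right _ (abs_min_sub_min_le_max _ _ _ _))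
  have hmax := (abs_max_sub_max_le_max (max (l 0) (l 1 + p.1)) (l 2 + p.2)
    (max (l 0) (l 1 + p'.1)) (l 2 + p'.2)).trans
      (max_le_max_right _ (abs_max_sub_max_le_max _ _ _ _))
  have hb : ∀ a b c : ℝ, max (max |a - a| |b + p.1 - (b + p'.1)|) |c + p.2 - (c + p'.2)| ≤
      |p.1 - p'.1| + |p.2 - p'.2| := fun a b c => by
    rw [sub_self, abs_zero, add_sub_add_left_eq_sub, add_sub_add_left_eq_sub]
    refine max_le (max_le (by positivity) ?_) ?_
    · exact le_add_of_nonneg_right (abs_nonneg _)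
    · exact le_add_of_nonneg_left (abs_nonneg _)
  have h1 := hmin.trans (hb _ _ _)
  have h2 := hmax.trans (hb _ _ _)
  refine (abs_max_sub_max_le_max _ _ _ _).trans (max_le (by simp; positivity) ?_)
  rw [sub_sub_sub_comm]
  refine (abs_sub _ _).trans ?_
  linarith

/-- `overlap l r` as a bounded continuous function. -/
def overlapBCF (l r : Fin 3 → ℝ) : (ℝ × ℝ) →ᵇ ℝ :=
  BoundedContinuousFunction.ofNormedAddCommGroup (overlap l r) (by unfold overlap; fun_prop)
    |r 0 - l 0| fun p => by
      rw [Real.norm_eq_abs, abs_of_nonneg (overlap_nonneg l r p)]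
      exact overlap_le l r p

/-- Three points of the fibre through `z`, at heights `z.2`, `z.2 - p.1` and `z.2 - p.2`. -/
def fiberTriple {X : Type*} (p : ℝ × ℝ) (z : X × ℝ) : (X × ℝ) × (X × ℝ) × (X × ℝ) :=
  (z, (z.1, z.2 - p.1), (z.1, z.2 - p.2))

lemma volume_fiberTriple_box {X : Type*} (A : Fin 3 → Set X) (l r : Fin 3 → ℝ) (p : ℝ × ℝ) (x : X) :
    volume {s : ℝ | fiberTriple p (x, s) ∈ (A 0 ×ˢ Set.Ioc (l 0) (r 0)) ×ˢ
      (A 1 ×ˢ Set.Ioc (l 1) (r 1)) ×ˢ (A 2 ×ˢ Set.Ioc (l 2) (r 2))} =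
    (A 0 ∩ A 1 ∩ A 2).indicator (fun _ => ENNReal.ofReal (overlap l r p)) x := by
  by_cases hx : x ∈ A 0 ∩ A 1 ∩ A 2
  · rw [Set.indicator_of_mem hx, ← volume_inter_translates]
    congr 1
    ext s
    simp [fiberTriple, hx.1.1, hx.1.2, hx.2]
  · rw [Set.indicator_of_notMem hx]
    convert measure_empty (μ := (volume : Measure ℝ))
    refine Set.eq_empty_of_forall_notMem fun s hs => hx ?_
    exact ⟨⟨hs.1.1, hs.2.1.1⟩, hs.2.2.1⟩

variable {X : Type*} [MeasurableSpace X] {T : X ≃ᵐ X} {f : X → ℝ} {μ : Measure X}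

lemma measurable_fiberTriple :
    Measurable fun w : (ℝ × ℝ) × (X × ℝ) => fiberTriple w.1 w.2 := by
  unfold fiberTriple
  fun_prop

/-- The distribution of fibre triples, with offsets depending on the base point. -/
def fiberLaw (μ : Measure X) (F : X → ℝ × ℝ) : Measure ((X × ℝ) × (X × ℝ) × (X × ℝ)) :=
  (μ.prod volume).map fun z => fiberTriple (F z.1) z

/-- The distribution of fibre triples, with random offsets independent of the base point. -/
def mixedFiberLaw (μ : Measure X) (P : Measure (ℝ × ℝ)) :
    Measure ((X × ℝ) × (X × ℝ) × (X × ℝ)) :=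
  (P.prod (μ.prod volume)).map fun w => fiberTriple w.1 w.2

lemma measurable_fiberTriple_comp {F : X → ℝ × ℝ} (hF : Measurable F) :
    Measurable fun z : X × ℝ => fiberTriple (F z.1) z :=
  measurable_fiberTriple.comp ((hF.comp measurable_fst).prodMk measurable_id)

lemma measurableSet_box {A : Fin 3 → Set X} (hA : ∀ i, MeasurableSet (A i)) (l r : Fin 3 → ℝ) :
    MeasurableSet ((A 0 ×ˢ Set.Ioc (l 0) (r 0)) ×ˢ
      (A 1 ×ˢ Set.Ioc (l 1) (r 1)) ×ˢ (A 2 ×ˢ Set.Ioc (l 2) (r 2))) :=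
  ((hA 0).prod measurableSet_Ioc).prod
    (((hA 1).prod measurableSet_Ioc).prod ((hA 2).prod measurableSet_Ioc))

/-- Integrating out the height leaves a bounded Lipschitz function of the offsets, which is exactly
what stable convergence can test. -/
lemma fiberLaw_box {F : X → ℝ × ℝ} (hF : Measurable F) {A : Fin 3 → Set X}
    (hA : ∀ i, MeasurableSet (A i)) (l r : Fin 3 → ℝ) :
    fiberLaw μ F ((A 0 ×ˢ Set.Ioc (l 0) (r 0)) ×ˢ
      (A 1 ×ˢ Set.Ioc (l 1) (r 1)) ×ˢ (A 2 ×ˢ Set.Ioc (l 2) (r 2))) =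
    ∫⁻ x in A 0 ∩ A 1 ∩ A 2, ENNReal.ofReal (overlap l r (F x)) ∂μ := by
  have hm := measurable_fiberTriple_comp hF
  rw [fiberLaw, Measure.map_apply hm (measurableSet_box hA l r),
    Measure.prod_apply (hm (measurableSet_box hA l r)),
    ← lintegral_indicator (((hA 0).inter (hA 1)).inter (hA 2))]
  refine lintegral_congr fun x => ?_
  exact volume_fiberTriple_box A l r (F x) x

lemma mixedFiberLaw_box [IsFiniteMeasure μ] {P : Measure (ℝ × ℝ)} [SFinite P] {A : Fin 3 → Set X}
    (hA : ∀ i, MeasurableSet (A i)) (l r : Fin 3 → ℝ) :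
    mixedFiberLaw μ P ((A 0 ×ˢ Set.Ioc (l 0) (r 0)) ×ˢ
      (A 1 ×ˢ Set.Ioc (l 1) (r 1)) ×ˢ (A 2 ×ˢ Set.Ioc (l 2) (r 2))) =
    μ (A 0 ∩ A 1 ∩ A 2) * ∫⁻ p, ENNReal.ofReal (overlap l r p) ∂P := by
  have hm := measurable_fiberTriple (X := X)
  rw [mixedFiberLaw, Measure.map_apply hm (measurableSet_box hA l r),
    Measure.prod_apply (hm (measurableSet_box hA l r)),
    ← lintegral_const_mul' _ _ (measure_ne_top _ _)]
  refine lintegral_congr fun p => ?_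
  have h1 : ∀ p : ℝ × ℝ, fiberLaw μ (fun _ => p) ((A 0 ×ˢ Set.Ioc (l 0) (r 0)) ×ˢ
      (A 1 ×ˢ Set.Ioc (l 1) (r 1)) ×ˢ (A 2 ×ˢ Set.Ioc (l 2) (r 2))) =
      μ (A 0 ∩ A 1 ∩ A 2) * ENNReal.ofReal (overlap l r p) := fun p => by
    rw [fiberLaw_box measurable_const hA, setLIntegral_const, mul_comm]
  rw [← h1 p, fiberLaw, Measure.map_apply (measurable_fiberTriple_comp measurable_const)
    (measurableSet_box hA l r)]
  rfl

/-- The slab of points of the suspension at height in `(-M, M]`. -/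
def slab (X : Type*) (M : ℝ) : Set (X × ℝ) := Set.univ ×ˢ Set.Ioc (-M) M

lemma measurableSet_slab (M : ℝ) : MeasurableSet (slab X M) :=
  MeasurableSet.univ.prod measurableSet_Ioc

lemma isFiniteMeasure_restrict_slab [IsFiniteMeasure μ] (M : ℝ) :
    IsFiniteMeasure ((μ.prod (volume : Measure ℝ)).restrict (slab X M)) := by
  refine ⟨?_⟩
  rw [Measure.restrict_apply_univ, slab, Measure.prod_prod, Real.volume_Ioc]
  exact ENNReal.mul_lt_top (measure_lt_top _ _) ENNReal.ofReal_lt_top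

/-- The marginals are bounded by the infinite measure `μ ⊗ Leb`; confining the triples to a slab
gives the finite bound that the π-system argument needs. -/
lemma map_restrict_prod_le {Y Z : Type*} [MeasurableSpace Y] [MeasurableSpace Z] {κ : Measure Y}
    {m : Measure Z} {g : Y → Z} (hg : Measurable g) (hκ : κ.map g ≤ m) {K : Set Z}
    (hK : MeasurableSet K) {E : Set Y} (hE : E ⊆ g ⁻¹' K) :
    (κ.restrict E).map g ≤ m.restrict K := by
  refine Measure.le_iff.2 fun S hS => ?_
  rw [map_restrict_fst_apply _ hg _ hS, Measure.restrict_apply hS]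
  calc κ (g ⁻¹' S ∩ E) ≤ κ (g ⁻¹' (S ∩ K)) := measure_mono fun y hy => ⟨hy.1, hE hy.2⟩
    _ = κ.map g (S ∩ K) := (Measure.map_apply hg (hS.inter hK)).symm
    _ ≤ m (S ∩ K) := hκ _

/-- Here and in the next two lemmas, each coordinate of a fibre triple is a measure-preserving shear
of `X × ℝ`. -/
lemma fiberLaw_map_fst [SFinite μ] {F : X → ℝ × ℝ} (hF : Measurable F) :
    (fiberLaw μ F).map (fun y => y.1) = μ.prod volume := by
  rw [fiberLaw, Measure.map_map (by fun_prop) (measurable_fiberTriple_comp hF)]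
  exact Measure.map_id

lemma fiberLaw_map_snd [SFinite μ] {F : X → ℝ × ℝ} (hF : Measurable F) :
    (fiberLaw μ F).map (fun y => y.2.1) = μ.prod volume := by
  rw [fiberLaw, Measure.map_map (by fun_prop) (measurable_fiberTriple_comp hF)]
  exact (measurePreserving_fiber_sub (by fun_prop : Measurable fun x => (F x).1)
    (MeasurePreserving.id μ)).map_eq

lemma fiberLaw_map_thd [SFinite μ] {F : X → ℝ × ℝ} (hF : Measurable F) :
    (fiberLaw μ F).map (fun y => y.2.2) = μ.prod volume := by
  rw [fiberLaw, Measure.map_map (by fun_prop) (measurable_fiberTriple_comp hF)]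
  exact (measurePreserving_fiber_sub (by fun_prop : Measurable fun x => (F x).2)
    (MeasurePreserving.id μ)).map_eq

lemma mixedFiberLaw_apply [SFinite μ] {P : Measure (ℝ × ℝ)}
    {E : Set ((X × ℝ) × (X × ℝ) × (X × ℝ))} (hE : MeasurableSet E) :
    mixedFiberLaw μ P E = ∫⁻ p, fiberLaw μ (fun _ => p) E ∂P := by
  rw [mixedFiberLaw, Measure.map_apply measurable_fiberTriple hE,
    Measure.prod_apply (measurable_fiberTriple hE)]
  refine lintegral_congr fun p => ?_
  rw [fiberLaw, Measure.map_apply (measurable_fiberTriple_comp measurable_const) hE]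
  rfl

lemma mixedFiberLaw_map_eq [SFinite μ] {P : Measure (ℝ × ℝ)} [IsProbabilityMeasure P]
    {g : (X × ℝ) × (X × ℝ) × (X × ℝ) → X × ℝ} (hg : Measurable g)
    (h : ∀ p : ℝ × ℝ, (fiberLaw μ fun _ => p).map g = μ.prod volume) :
    (mixedFiberLaw μ P).map g = μ.prod volume := by
  refine Measure.ext fun S hS => ?_
  rw [Measure.map_apply hg hS, mixedFiberLaw_apply (hg hS)]
  simp only [← Measure.map_apply hg hS, h]
  simp

lemma smul_le_self_of_le_one {Z : Type*} [MeasurableSpace Z] {m : Measure Z} {c : ENNReal}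
    (hc : c ≤ 1) : c • m ≤ m :=
  Measure.le_iff.2 fun _ _ => mul_le_of_le_one_left' hc

lemma exists_eq_prod_Ioc_inter_slab {A : Set (X × ℝ)} (M : ℝ)
    (hA : A ∈ Set.image2 (fun (A : Set X) (I : Set ℝ) => A ×ˢ I) {A | MeasurableSet A}
      {I | ∃ l u, l < u ∧ Set.Ioc l u = I}) :
    ∃ (A₀ : Set X) (l r : ℝ), MeasurableSet A₀ ∧ A ∩ slab X M = A₀ ×ˢ Set.Ioc l r := by
  obtain ⟨A₀, hA₀, I, ⟨l, u, -, rfl⟩, rfl⟩ := hA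
  refine ⟨A₀, max l (-M), min u M, hA₀, ?_⟩
  rw [slab, Set.prod_inter_prod, Set.inter_univ, Set.Ioc_inter_Ioc]

lemma isCountablySpanning_Ioc :
    IsCountablySpanning {I : Set ℝ | ∃ l u, l < u ∧ Set.Ioc l u = I} := by
  refine ⟨fun n => Set.Ioc (-((n : ℝ) + 1)) (n + 1), fun n =>
    ⟨_, _, by linarith [n.cast_nonneg (α := ℝ)], rfl⟩, ?_⟩
  refine Set.eq_univ_of_forall fun x => ?_
  obtain ⟨n, hn⟩ := exists_nat_gt |x|
  have := abs_lt.1 hn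
  exact Set.mem_iUnion.2 ⟨n, by constructor <;> linarith [this.1, this.2]⟩

/-- The offsets at the base point `x`: the normalized Birkhoff sums of lengths `q' n`, `q n`. -/
def offsets (T : X ≃ᵐ X) (f : X → ℝ) (q q' : ℕ → ℕ) (a a' : ℕ → ℝ) (n : ℕ) (x : X) : ℝ × ℝ :=
  (cocycle T f (q' n) x - a' n, cocycle T f (q n) x - a n)

lemma measurable_offsets (hfm : Measurable f) (q q' : ℕ → ℕ) (a a' : ℕ → ℝ) (n : ℕ) :
    Measurable (offsets T f q q' a a' n) :=
  ((measurable_cocycle T hfm _).sub_const _).prodMk ((measurable_cocycle T hfm _).sub_const _)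

/-- The distributions over `W n` of the fibre triples with offsets given by the normalized Birkhoff
sums converge, on boxes of bounded height, to the mixture over `P`. -/
lemma tendsto_fiberLaw_slab [IsProbabilityMeasure μ] (hT : Ergodic T μ)
    (hfm : Measurable f) (hf : ∀ x, 0 < f x) (hfi : Integrable f μ)
    {W : ℕ → Set X} (hW : ∀ n, MeasurableSet (W n)) {q q' : ℕ → ℕ} {a a' : ℕ → ℝ} {α : ℝ}
    {P : Measure (ℝ × ℝ)} [IsProbabilityMeasure P]
    (h : PartialRigidityConditions μ T f W q q' a a' α P) {M : ℝ} (hM : 0 < M)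
    {A B C : Set (X × ℝ)} (hA : MeasurableSet A) (hB : MeasurableSet B) (hC : MeasurableSet C) :
    Tendsto (fun n => fiberLaw (μ.restrict (W n)) (offsets T f q q' a a' n)
      ((A ∩ slab X M) ×ˢ (B ∩ slab X M) ×ˢ (C ∩ slab X M))) atTop
      (𝓝 (ENNReal.ofReal α * mixedFiberLaw μ P
        ((A ∩ slab X M) ×ˢ (B ∩ slab X M) ×ˢ (C ∩ slab X M)))) := by
  have hF := measurable_offsets (T := T) hfm q q' a a'
  have hKm := measurableSet_slab (X := X) M
  have := isFiniteMeasure_restrict_slab (μ := μ) M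
  let E : Set ((X × ℝ) × (X × ℝ) × (X × ℝ)) := slab X M ×ˢ slab X M ×ˢ slab X M
  have hEm : MeasurableSet E := hKm.prod (hKm.prod hKm)
  have hrestr : ∀ (κ : Measure ((X × ℝ) × (X × ℝ) × (X × ℝ))) (A B C : Set (X × ℝ)),
      κ.restrict E (A ×ˢ B ×ˢ C) =
        κ ((A ∩ slab X M) ×ˢ (B ∩ slab X M) ×ˢ (C ∩ slab X M)) := fun κ A B C => by
    rw [Measure.restrict_apply' hEm, Set.prod_inter_prod, Set.prod_inter_prod]
  have hle : ∀ n, (μ.restrict (W n)).prod (volume : Measure ℝ) ≤ μ.prod volume := fun n =>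
    Measure.prod_mono Measure.restrict_le_self le_rfl
  have hα : ENNReal.ofReal α ≤ 1 := by simpa using ENNReal.ofReal_le_ofReal h.le_one
  have hmix : ∀ {g : (X × ℝ) × (X × ℝ) × (X × ℝ) → X × ℝ}, Measurable g →
      (∀ p : ℝ × ℝ, (fiberLaw μ fun _ => p).map g = μ.prod volume) → E ⊆ g ⁻¹' slab X M →
      ((ENNReal.ofReal α • mixedFiberLaw μ P).restrict E).map g ≤
        (μ.prod volume).restrict (slab X M) := fun hg h1 h2 =>
    map_restrict_prod_le hg (by
      rw [Measure.map_smul, mixedFiberLaw_map_eq hg h1]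
      exact smul_le_self_of_le_one hα) hKm h2
  have hE1 : E ⊆ (fun y => y.1) ⁻¹' slab X M := fun y hy => hy.1
  have hE2 : E ⊆ (fun y => y.2.1) ⁻¹' slab X M := fun y hy => hy.2.1
  have hE3 : E ⊆ (fun y => y.2.2) ⁻¹' slab X M := fun y hy => hy.2.2
  have key := tendsto_measure_prod_prod_of_isPiSystem
    (m := (μ.prod (volume : Measure ℝ)).restrict (slab X M))
    (κ := fun n => (fiberLaw (μ.restrict (W n)) (offsets T f q q' a a' n)).restrict E)
    (σ := (ENNReal.ofReal α • mixedFiberLaw μ P).restrict E)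
    (fun n => map_restrict_prod_le (by fun_prop) ((fiberLaw_map_fst (hF n)).trans_le (hle n))
      hKm hE1)
    (fun n => map_restrict_prod_le (by fun_prop) ((fiberLaw_map_snd (hF n)).trans_le (hle n))
      hKm hE2)
    (fun n => map_restrict_prod_le (by fun_prop) ((fiberLaw_map_thd (hF n)).trans_le (hle n))
      hKm hE3)
    (hmix (by fun_prop) (fun p => fiberLaw_map_fst measurable_const) hE1)
    (hmix (by fun_prop) (fun p => fiberLaw_map_snd measurable_const) hE2)
    (hmix (by fun_prop) (fun p => fiberLaw_map_thd measurable_const) hE3)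
    (𝒞 := Set.image2 (fun (A : Set X) (I : Set ℝ) => A ×ˢ I) {A | MeasurableSet A}
      {I | ∃ l u, l < u ∧ Set.Ioc l u = I})
    (by
      rw [← generateFrom_prod_eq isCountablySpanning_measurableSet isCountablySpanning_Ioc,
        MeasurableSpace.generateFrom_measurableSet, ← borel_eq_generateFrom_Ioc,
        ← BorelSpace.measurable_eq])
    (MeasurableSpace.isPiSystem_measurableSet.prod (isPiSystem_Ioc _root_.id _root_.id))
    (K := slab X M) ⟨Set.univ, MeasurableSet.univ, _, ⟨-M, M, by linarith, rfl⟩, rfl⟩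
    (by rw [Measure.restrict_apply hKm.compl, Set.compl_inter_self, measure_empty]) ?_ hA hB hC
  · simpa only [hrestr, Measure.smul_apply, smul_eq_mul] using key
  -- Only the generating rectangles remain. Cutting them with the slab gives rectangles again, so
  -- the box formulas and stable convergence for `overlapBCF` apply.
  intro A hA B hB C hC
  obtain ⟨A₀, l₀, r₀, hA₀, eA⟩ := exists_eq_prod_Ioc_inter_slab M hA
  obtain ⟨A₁, l₁, r₁, hA₁, eB⟩ := exists_eq_prod_Ioc_inter_slab M hB
  obtain ⟨A₂, l₂, r₂, hA₂, eC⟩ := exists_eq_prod_Ioc_inter_slab M hC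
  simp only [hrestr, Measure.smul_apply, smul_eq_mul, eA, eB, eC]
  let D : Fin 3 → Set X := ![A₀, A₁, A₂]
  let l : Fin 3 → ℝ := ![l₀, l₁, l₂]
  let r : Fin 3 → ℝ := ![r₀, r₁, r₂]
  have hD : ∀ i, MeasurableSet (D i) := by
    intro i
    fin_cases i <;> assumption
  have hD' : MeasurableSet (D 0 ∩ D 1 ∩ D 2) := ((hD 0).inter (hD 1)).inter (hD 2)
  have h1 := fun n => fiberLaw_box (μ := μ.restrict (W n)) (hF n) hD l r
  have h2 := mixedFiberLaw_box (μ := μ) (P := P) hD l r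
  change Tendsto (fun n => fiberLaw (μ.restrict (W n)) (offsets T f q q' a a' n)
    ((D 0 ×ˢ Set.Ioc (l 0) (r 0)) ×ˢ (D 1 ×ˢ Set.Ioc (l 1) (r 1)) ×ˢ
      (D 2 ×ˢ Set.Ioc (l 2) (r 2)))) atTop (𝓝 (ENNReal.ofReal α * mixedFiberLaw μ P
    ((D 0 ×ˢ Set.Ioc (l 0) (r 0)) ×ˢ (D 1 ×ˢ Set.Ioc (l 1) (r 1)) ×ˢ
      (D 2 ×ˢ Set.Ioc (l 2) (r 2)))))
  simp only [h1, h2]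
  have hlim := tendsto_setIntegral_of_partialRigidity hT hfm hf hfi hW h (overlapBCF l r)
    (L := 2) (by norm_num) (abs_overlap_sub_le l r) hD'
  have hconv : ∀ (ν : Measure (ℝ × ℝ)) [IsFiniteMeasure ν],
      ENNReal.ofReal (∫ p, overlapBCF l r p ∂ν) = ∫⁻ p, ENNReal.ofReal (overlap l r p) ∂ν :=
    fun ν _ => ofReal_integral_eq_lintegral_ofReal ((overlapBCF l r).integrable ν)
      (ae_of_all _ (overlap_nonneg l r))
  have hlim' := ENNReal.tendsto_ofReal hlim
  convert hlim' using 2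
  · rename_i n
    rw [Measure.restrict_restrict hD']
    have hi : Integrable (fun x => overlapBCF l r (offsets T f q q' a a' n x))
        (μ.restrict (D 0 ∩ D 1 ∩ D 2 ∩ W n)) :=
      Integrable.of_bound
        ((overlapBCF l r).continuous.measurable.comp (hF n)).aestronglyMeasurable _
        (ae_of_all _ fun x => (overlapBCF l r).norm_coe_le_norm _)
    exact (ofReal_integral_eq_lintegral_ofReal hi (ae_of_all _ fun x => overlap_nonneg l r _)).symm
  · rw [ENNReal.ofReal_mul measureReal_nonneg, ENNReal.ofReal_mul h.pos.le, hconv, Measure.real,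
      ENNReal.ofReal_toReal (measure_ne_top _ _)]
    ring

end TripleConvergence

/-! ### Rigidity: off-diagonal joinings dominate the limiting mixture. -/

section FlowTriples

variable {X : Type*} [MeasurableSpace X] {T : X ≃ᵐ X} {f : X → ℝ} {μ : Measure X}

/-- The off-diagonal self-joining of the special flow with times `0`, `t` and `u`. -/
def flowJoining (μ : Measure X) (T : X ≃ᵐ X) (f : X → ℝ) (t u : ℝ) :
    Measure (SpecialSpace f × SpecialSpace f × SpecialSpace f) :=
  (specialMeasure μ f).map fun y => (y, specialFlow T f t y, specialFlow T f u y)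

lemma measurable_flowTriple (hf : ∀ x, 0 < f x) (hfm : Measurable f) (t u : ℝ) :
    Measurable fun y => (y, specialFlow T f t y, specialFlow T f u y) :=
  measurable_id.prodMk
    ((measurable_specialFlow_const hf hfm t).prodMk (measurable_specialFlow_const hf hfm u))

lemma flowJoining_apply (hf : ∀ x, 0 < f x) (hfm : Measurable f) (t u : ℝ)
    {A B C : Set (SpecialSpace f)} (hA : MeasurableSet A) (hB : MeasurableSet B)
    (hC : MeasurableSet C) :
    flowJoining μ T f t u (A ×ˢ B ×ˢ C) =
      specialMeasure μ f {y | y ∈ A ∧ specialFlow T f t y ∈ B ∧ specialFlow T f u y ∈ C} := by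
  rw [flowJoining, Measure.map_apply (measurable_flowTriple hf hfm t u) (hA.prod (hB.prod hC))]
  rfl

/-- Off-diagonal self-joinings lift to laws of fibre triples with constant offsets. -/
lemma flowJoining_eq_fiberLaw (hf : ∀ x, 0 < f x) (hfm : Measurable f)
    (hc : ∀ᵐ x ∂μ, Complete T f x) (p : ℝ × ℝ)
    {A B C : Set (SpecialSpace f)} (hA : MeasurableSet A) (hB : MeasurableSet B)
    (hC : MeasurableSet C) :
    flowJoining μ T f (-p.1) (-p.2) (A ×ˢ B ×ˢ C) = fiberLaw μ (fun _ => p)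
      ((Subtype.val '' A) ×ˢ (flowFrom T hf ⁻¹' B) ×ˢ (flowFrom T hf ⁻¹' C)) := by
  have hA' : MeasurableSet (Subtype.val '' A : Set (X × ℝ)) :=
    (MeasurableEmbedding.subtype_coe (measurableSet_underGraph hfm)).measurableSet_image.2 hA
  have hg := measurable_flowFrom (T := T) hf hfm
  rw [flowJoining_apply hf hfm _ _ hA hB hC, fiberLaw,
    Measure.map_apply (measurable_fiberTriple_comp measurable_const)
      (hA'.prod ((hg hB).prod (hg hC))), specialMeasure_apply hfm]
  refine measure_congr_of_ae_iff ?_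
  filter_upwards [ae_prod_of_ae_fst (ν := (volume : Measure ℝ)) hc] with z hz
  constructor
  · rintro ⟨y, ⟨h1, h2, h3⟩, rfl⟩
    rw [specialFlow_eq_flowFrom hf hz] at h2 h3
    exact ⟨⟨y, h1, rfl⟩, h2, h3⟩
  · rintro ⟨⟨y, h1, h4⟩, h2, h3⟩
    have h4 : y.1 = z := h4
    subst h4
    refine ⟨y, ⟨h1, ?_, ?_⟩, rfl⟩
    · rw [specialFlow_eq_flowFrom hf hz]
      exact h2
    · rw [specialFlow_eq_flowFrom hf hz]
      exact h3

/-- Along a rigidity sequence, measurable subsets of a bounded slab are asymptotically invariant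
over the sets `W n`, uniformly in the height. -/
lemma tendsto_prod_slab_of_rigid [IsFiniteMeasure μ] {r : ℕ → ℕ} {W : ℕ → Set X}
    (h : IsRigiditySequenceAlong μ T r W) {D : Set (X × ℝ)}
    (hD : MeasurableSet D) (M : ℝ) :
    Tendsto (fun n => ((μ.restrict (W n)).prod volume)
      {z : X × ℝ | z ∈ D ∩ slab X M ∧ (iter T (r n) z.1, z.2) ∉ D}) atTop (𝓝 0) := by
  have hm : ∀ n, MeasurableSet
      {z : X × ℝ | z ∈ D ∩ slab X M ∧ (iter T (r n) z.1, z.2) ∉ D} := fun n =>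
    (hD.inter (measurableSet_slab M)).inter
      ((((measurable_iter T (r n)).comp measurable_fst).prodMk measurable_snd) hD).compl
  simp only [Measure.prod_apply_symm (hm _)]
  rw [← lintegral_zero (μ := (volume : Measure ℝ))]
  refine tendsto_lintegral_of_dominated_convergence
    ((Set.Ioc (-M) M).indicator fun _ => μ Set.univ)
    (fun n => measurable_measure_prodMk_right (hm n)) (fun n => ae_of_all _ fun s => ?_) ?_
    (ae_of_all _ fun s => ?_)
  · by_cases hs : s ∈ Set.Ioc (-M) M
    · rw [Set.indicator_of_mem hs]
      exact (Measure.restrict_apply_le _ _).trans (measure_mono (Set.subset_univ _))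
    · rw [Set.indicator_of_notMem hs]
      refine (measure_mono_null ?_ measure_empty).le
      exact fun x hx => hs hx.1.2.2
  · rw [lintegral_indicator measurableSet_Ioc, setLIntegral_const, Real.volume_Ioc]
    exact ENNReal.mul_ne_top (measure_ne_top _ _) ENNReal.ofReal_ne_top
  · have hDs : MeasurableSet {x : X | (x, s) ∈ D} := measurable_prodMk_right hD
    refine tendsto_of_tendsto_of_tendsto_of_le_of_le tendsto_const_nhds (h.2 _ hDs)
      (fun n => zero_le) fun n => ?_
    rw [Measure.restrict_apply (measurable_prodMk_right (hm n))]
    exact measure_mono fun x hx => ⟨Or.inr ⟨hx.1.1.1, hx.1.2⟩, hx.2⟩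

lemma le_liminf_of_le_add {k e N : ℕ → ENNReal} {k₀ : ENNReal} (hk : Tendsto k atTop (𝓝 k₀))
    (he : Tendsto e atTop (𝓝 0)) (h : ∀ n, k n ≤ N n + e n) : k₀ ≤ liminf N atTop := by
  have h1 : Tendsto (fun n => k n - e n) atTop (𝓝 k₀) := by
    simpa using ENNReal.Tendsto.sub hk he (Or.inr ENNReal.zero_ne_top)
  rw [← h1.liminf_eq]
  exact liminf_le_liminf (Eventually.of_forall fun n => tsub_le_iff_right.2 (h n))

/-- The flow moves a point over `x ∈ W n` by time `a n` approximately to the point that is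
`offsets` below it, since `T ^ q n` is close to the identity there. -/
lemma fiberLaw_slab_le [SFinite μ] (hf : ∀ x, 0 < f x) (hfm : Measurable f)
    (hc : ∀ᵐ x ∂μ, Complete T f x) (W : ℕ → Set X) (q q' : ℕ → ℕ) (a a' : ℕ → ℝ) (M : ℝ) (n : ℕ)
    {A : Set (X × ℝ)} (hA : MeasurableSet A) {B C : Set (SpecialSpace f)} (hB : MeasurableSet B)
    (hC : MeasurableSet C) :
    fiberLaw (μ.restrict (W n)) (offsets T f q q' a a' n)
      ((A ∩ slab X M) ×ˢ (flowFrom T hf ⁻¹' B ∩ slab X M) ×ˢ (flowFrom T hf ⁻¹' C ∩ slab X M)) ≤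
    fiberLaw μ (fun _ => (-a' n, -a n)) (A ×ˢ (flowFrom T hf ⁻¹' B) ×ˢ (flowFrom T hf ⁻¹' C)) +
      (((μ.restrict (W n)).prod volume) {z : X × ℝ | z ∈ flowFrom T hf ⁻¹' B ∩ slab X M ∧
          (iter T (q' n) z.1, z.2) ∉ flowFrom T hf ⁻¹' B} +
        ((μ.restrict (W n)).prod volume) {z : X × ℝ | z ∈ flowFrom T hf ⁻¹' C ∩ slab X M ∧
          (iter T (q n) z.1, z.2) ∉ flowFrom T hf ⁻¹' C}) := by
  have hg := measurable_flowFrom (T := T) hf hfm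
  have hF := measurable_offsets (T := T) hfm q q' a a' n
  have hK := measurableSet_slab (X := X) M
  have hbad : ∀ (r : ℕ) {D : Set (SpecialSpace f)}, MeasurableSet D → MeasurableSet
      {z : X × ℝ | z ∈ flowFrom T hf ⁻¹' D ∩ slab X M ∧
        (iter T r z.1, z.2) ∉ flowFrom T hf ⁻¹' D} := fun r D hD =>
    ((hg hD).inter hK).inter
      ((((measurable_iter T r).comp measurable_fst).prodMk measurable_snd) (hg hD)).compl
  rw [fiberLaw, Measure.map_apply (measurable_fiberTriple_comp hF)
      ((hA.inter hK).prod (((hg hB).inter hK).prod ((hg hC).inter hK))),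
    fiberLaw, Measure.map_apply (measurable_fiberTriple_comp measurable_const)
      (hA.prod ((hg hB).prod (hg hC))),
    ← (measurePreserving_fiber_sub (μ := μ.restrict (W n)) hF.fst
      (MeasurePreserving.id _)).measure_preimage (hbad (q' n) hB).nullMeasurableSet,
    ← (measurePreserving_fiber_sub (μ := μ.restrict (W n)) hF.snd
      (MeasurePreserving.id _)).measure_preimage (hbad (q n) hC).nullMeasurableSet]
  have hle : (μ.restrict (W n)).prod (volume : Measure ℝ) ≤ μ.prod volume :=
    Measure.prod_mono Measure.restrict_le_self le_rfl
  refine le_trans ?_ (add_le_add (hle _) (measure_union_le _ _))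
  refine le_trans ?_ (measure_union_le _ _)
  refine measure_mono_ae ?_
  have hc' : ∀ᵐ z : X × ℝ ∂(μ.restrict (W n)).prod volume, Complete T f z.1 :=
    ae_prod_of_ae_fst (ae_restrict_of_ae hc)
  filter_upwards [hc'] with z hz
  intro hzm
  -- Exact identity behind the approximation: the point below `z` by the normalized sum, moved from
  -- `x` to `T^r x`, represents the flow image of `z` after time `b`. The only error is replacing
  -- `x` by `T^r x`, which the two bad sets record.
  have key : ∀ (r : ℕ) (b : ℝ), flowFrom T hf (iter T r z.1, z.2 - (cocycle T f r z.1 - b)) =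
      flowFrom T hf (z.1, z.2 - (-b)) := fun r b => by
    rw [← flowFrom_iter hf hz r (z.2 - (-b))]
    congr 2
    ring
  obtain ⟨h1, h2, h3⟩ := hzm
  by_cases hb : flowFrom T hf (z.1, z.2 - (-a' n)) ∈ B
  · by_cases hcc : flowFrom T hf (z.1, z.2 - (-a n)) ∈ C
    · exact Or.inl ⟨h1.1, hb, hcc⟩
    · refine Or.inr (Or.inr ⟨h3, fun hmem => hcc ?_⟩)
      rw [← key (q n) (a n)]
      exact hmem
  · refine Or.inr (Or.inl ⟨h2, fun hmem => hb ?_⟩)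
    rw [← key (q' n) (a' n)]
    exact hmem

/-- The off-diagonal self-joinings with times `0`, `a' n`, `a n` asymptotically dominate, on boxes,
`α` times the mixture over `P` of off-diagonal self-joinings. -/
lemma mixture_le_liminf_flowJoining [IsProbabilityMeasure μ] (hT : Ergodic T μ)
    (hfm : Measurable f) (hf : ∀ x, 0 < f x) (hfi : Integrable f μ)
    {W : ℕ → Set X} (hW : ∀ n, MeasurableSet (W n)) {q q' : ℕ → ℕ} {a a' : ℕ → ℝ} {α : ℝ}
    {P : Measure (ℝ × ℝ)} [IsProbabilityMeasure P]
    (h : PartialRigidityConditions μ T f W q q' a a' α P)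
    {A B C : Set (SpecialSpace f)} (hA : MeasurableSet A) (hB : MeasurableSet B)
    (hC : MeasurableSet C) :
    ENNReal.ofReal α * ∫⁻ p, flowJoining μ T f (-p.1) (-p.2) (A ×ˢ B ×ˢ C) ∂P ≤
      liminf (fun n => flowJoining μ T f (a' n) (a n) (A ×ˢ B ×ˢ C)) atTop := by
  have hc := ae_complete hT.toMeasurePreserving hfm hf
  have hg := measurable_flowFrom (T := T) hf hfm
  have hA' : MeasurableSet (Subtype.val '' A : Set (X × ℝ)) :=
    (MeasurableEmbedding.subtype_coe (measurableSet_underGraph hfm)).measurableSet_image.2 hA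
  simp only [flowJoining_eq_fiberLaw hf hfm hc _ hA hB hC]
  rw [← mixedFiberLaw_apply (hA'.prod ((hg hB).prod (hg hC)))]
  have hN : ∀ n, flowJoining μ T f (a' n) (a n) (A ×ˢ B ×ˢ C) =
      fiberLaw μ (fun _ => (-a' n, -a n))
        ((Subtype.val '' A) ×ˢ (flowFrom T hf ⁻¹' B) ×ˢ (flowFrom T hf ⁻¹' C)) := fun n => by
    rw [← flowJoining_eq_fiberLaw hf hfm hc _ hA hB hC]
    simp only [neg_neg]
  simp only [hN]
  -- The first factor lies under the roof, so each point of `X^f` is counted once; the others allow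
  -- every representative. Convergence is known only in bounded slabs, but a lower bound survives
  -- exhaustion by them.
  let E : ℕ → Set ((X × ℝ) × (X × ℝ) × (X × ℝ)) := fun k =>
    ((Subtype.val '' A) ∩ slab X (k + 1)) ×ˢ (flowFrom T hf ⁻¹' B ∩ slab X (k + 1)) ×ˢ
      (flowFrom T hf ⁻¹' C ∩ slab X (k + 1))
  have hslab : Monotone fun k : ℕ => slab X ((k : ℝ) + 1) := fun k l hkl =>
    Set.prod_mono subset_rfl (Set.Ioc_subset_Ioc (by
      have : (k : ℝ) ≤ l := by exact_mod_cast hkl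
      linarith) (by
      have : (k : ℝ) ≤ l := by exact_mod_cast hkl
      linarith))
  have hE : Monotone E := fun k l hkl =>
    Set.prod_mono (Set.inter_subset_inter_right _ (hslab hkl))
      (Set.prod_mono (Set.inter_subset_inter_right _ (hslab hkl))
        (Set.inter_subset_inter_right _ (hslab hkl)))
  have hEu : ⋃ k, E k =
      (Subtype.val '' A) ×ˢ (flowFrom T hf ⁻¹' B) ×ˢ (flowFrom T hf ⁻¹' C) := by
    have hmem : ∀ z : X × ℝ, ∃ k : ℕ, ∀ l : ℕ, k ≤ l → z ∈ slab X ((l : ℝ) + 1) := fun z => by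
      obtain ⟨k, hk⟩ := exists_nat_gt |z.2|
      refine ⟨k, fun l hl => hslab hl ⟨trivial, ?_⟩⟩
      have := abs_lt.1 hk
      constructor <;> linarith [this.1, this.2]
    refine subset_antisymm (Set.iUnion_subset fun k => Set.prod_mono Set.inter_subset_left
      (Set.prod_mono Set.inter_subset_left Set.inter_subset_left)) ?_
    rintro ⟨x, y, z⟩ ⟨hx, hy, hz⟩
    obtain ⟨k1, h1⟩ := hmem x
    obtain ⟨k2, h2⟩ := hmem y
    obtain ⟨k3, h3⟩ := hmem z
    exact Set.mem_iUnion.2 ⟨max k1 (max k2 k3), ⟨hx, h1 _ (by simp)⟩, ⟨hy, h2 _ (by simp)⟩,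
      ⟨hz, h3 _ (by simp)⟩⟩
  have hlim := ENNReal.Tendsto.const_mul (a := ENNReal.ofReal α)
    (tendsto_measure_iUnion_atTop (μ := mixedFiberLaw μ P) hE) (Or.inr ENNReal.ofReal_ne_top)
  rw [hEu] at hlim
  refine le_of_tendsto' hlim fun k => ?_
  refine le_liminf_of_le_add
    (tendsto_fiberLaw_slab hT hfm hf hfi hW h (by positivity : (0 : ℝ) < (k : ℝ) + 1)
      hA' (hg hB) (hg hC)) ?_
    fun n => fiberLaw_slab_le hf hfm hc W q q' a a' _ n hA' hB hC
  simpa using (tendsto_prod_slab_of_rigid h.rigid' (hg hB) ((k : ℝ) + 1)).add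
    (tendsto_prod_slab_of_rigid h.rigid (hg hC) ((k : ℝ) + 1))

end FlowTriples

/-! ### From domination on boxes to a bound on complementary masses. -/

section BoxApproximation

lemma ENNReal.liminf_add_liminf_le (u v : ℕ → ENNReal) :
    liminf u atTop + liminf v atTop ≤ liminf (fun n => u n + v n) atTop := by
  simp only [liminf_eq_iSup_iInf_of_nat]
  rw [ENNReal.iSup_add_iSup_of_monotone
    (fun k l hkl => biInf_mono fun i hi => hkl.trans hi)
    (fun k l hkl => biInf_mono fun i hi => hkl.trans hi)]
  exact iSup_mono fun k => le_iInf₂ fun i hi => add_le_add (iInf₂_le i hi) (iInf₂_le i hi)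

lemma ENNReal.sum_liminf_le {ι : Type*} (s : Finset ι) (u : ι → ℕ → ENNReal) :
    ∑ i ∈ s, liminf (u i) atTop ≤ liminf (fun n => ∑ i ∈ s, u i n) atTop := by
  classical
  induction s using Finset.induction_on with
  | empty => simp
  | insert i s hi ih =>
    simp only [Finset.sum_insert hi]
    exact (add_le_add_right ih _).trans (ENNReal.liminf_add_liminf_le _ _)

variable {Y : Type*} [mY : MeasurableSpace Y]

/-- The sets in `Y × Y × Y` that are determined by the classes of the coordinates with respect to
some finite measurable partition of `Y`. -/
def finitelyDetermined (Y : Type*) [MeasurableSpace Y] : Set (Set (Y × Y × Y)) :=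
  {F | ∃ (ι : Type) (_ : Fintype ι) (g : Y → ι) (_ : ∀ i, MeasurableSet (g ⁻¹' {i}))
    (R : Set (ι × ι × ι)), F = (fun y => (g y.1, g y.2.1, g y.2.2)) ⁻¹' R}

/-- The two partitions have a common refinement, so Boolean operations can be carried out on the
index sets. -/
lemma finitelyDetermined_pair {F G : Set (Y × Y × Y)} (hF : F ∈ finitelyDetermined Y)
    (hG : G ∈ finitelyDetermined Y) : ∃ (ι : Type) (_ : Fintype ι) (g : Y → ι)
      (_ : ∀ i, MeasurableSet (g ⁻¹' {i})) (R S : Set (ι × ι × ι)),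
      F = (fun y => (g y.1, g y.2.1, g y.2.2)) ⁻¹' R ∧
      G = (fun y => (g y.1, g y.2.1, g y.2.2)) ⁻¹' S := by
  obtain ⟨ι, _, g, hg, R, rfl⟩ := hF
  obtain ⟨ι', _, g', hg', S, rfl⟩ := hG
  refine ⟨ι × ι', inferInstance, fun y => (g y, g' y), fun i => ?_,
    (fun w => (w.1.1, w.2.1.1, w.2.2.1)) ⁻¹' R, (fun w => (w.1.2, w.2.1.2, w.2.2.2)) ⁻¹' S,
    rfl, rfl⟩
  have : (fun y => (g y, g' y)) ⁻¹' {i} = g ⁻¹' {i.1} ∩ g' ⁻¹' {i.2} := by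
    ext y
    simp [Prod.ext_iff]
  rw [this]
  exact (hg _).inter (hg' _)

lemma univ_mem_finitelyDetermined : Set.univ ∈ finitelyDetermined Y :=
  ⟨Unit, inferInstance, fun _ => (), fun i => measurable_const (measurableSet_singleton i),
    Set.univ, rfl⟩

lemma isSetRing_finitelyDetermined : IsSetRing (finitelyDetermined Y) where
  empty_mem := ⟨Unit, inferInstance, fun _ => (),
    fun i => measurable_const (measurableSet_singleton i), ∅, rfl⟩
  union_mem F G hF hG := by
    obtain ⟨ι, _, g, hg, R, S, rfl, rfl⟩ := finitelyDetermined_pair hF hG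
    exact ⟨ι, ‹_›, g, hg, R ∪ S, rfl⟩
  sdiff_mem F G hF hG := by
    obtain ⟨ι, _, g, hg, R, S, rfl, rfl⟩ := finitelyDetermined_pair hF hG
    exact ⟨ι, ‹_›, g, hg, R \ S, rfl⟩

lemma measurableSet_preimage_prop {A : Set Y} (hA : MeasurableSet A) (p : Prop) :
    MeasurableSet ((fun y => y ∈ A) ⁻¹' {p}) := by
  by_cases h : p
  · convert hA using 1
    ext y
    simp [h]
  · convert hA.compl using 1
    ext y
    simp [h]

lemma coordinate_mem_finitelyDetermined {A : Set Y} (hA : MeasurableSet A) :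
    (fun y : Y × Y × Y => y.1) ⁻¹' A ∈ finitelyDetermined Y ∧
    (fun y : Y × Y × Y => y.2.1) ⁻¹' A ∈ finitelyDetermined Y ∧
    (fun y : Y × Y × Y => y.2.2) ⁻¹' A ∈ finitelyDetermined Y :=
  ⟨⟨Prop, inferInstance, fun y => y ∈ A, measurableSet_preimage_prop hA, {w | w.1}, rfl⟩,
    ⟨Prop, inferInstance, fun y => y ∈ A, measurableSet_preimage_prop hA, {w | w.2.1}, rfl⟩,
    ⟨Prop, inferInstance, fun y => y ∈ A, measurableSet_preimage_prop hA, {w | w.2.2}, rfl⟩⟩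

open Classical in
lemma measure_finitelyDetermined {ι : Type} [Fintype ι] {g : Y → ι}
    (hg : ∀ i, MeasurableSet (g ⁻¹' {i})) (R : Set (ι × ι × ι)) (ν : Measure (Y × Y × Y)) :
    ν ((fun y => (g y.1, g y.2.1, g y.2.2)) ⁻¹' R) =
      ∑ w ∈ R.toFinset, ν ((g ⁻¹' {w.1}) ×ˢ (g ⁻¹' {w.2.1}) ×ˢ (g ⁻¹' {w.2.2})) := by
  rw [← measure_biUnion_finset]
  · congr 1
    ext y
    simp only [Set.mem_preimage, Set.mem_toFinset, Set.mem_iUnion, Set.mem_prod,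
      Set.mem_singleton_iff, exists_prop]
    constructor
    · exact fun h => ⟨_, h, rfl, rfl, rfl⟩
    · rintro ⟨w, hw, h1, h2, h3⟩
      rwa [h1, h2, h3]
  · intro w _ w' _ hne
    refine Set.disjoint_left.2 fun y h h' => hne ?_
    exact Prod.ext (h.1.symm.trans h'.1)
      (Prod.ext (h.2.1.symm.trans h'.2.1) (h.2.2.symm.trans h'.2.2))
  · exact fun w _ => (hg _).prod ((hg _).prod (hg _))

lemma measurableSet_of_mem_finitelyDetermined {F : Set (Y × Y × Y)}
    (hF : F ∈ finitelyDetermined Y) : MeasurableSet F := by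
  obtain ⟨ι, _, g, hg, R, rfl⟩ := hF
  have : (fun y : Y × Y × Y => (g y.1, g y.2.1, g y.2.2)) ⁻¹' R =
      ⋃ w ∈ R, (g ⁻¹' {w.1}) ×ˢ (g ⁻¹' {w.2.1}) ×ˢ (g ⁻¹' {w.2.2}) := by
    ext y
    simp only [Set.mem_preimage, Set.mem_iUnion, Set.mem_prod, Set.mem_singleton_iff, exists_prop]
    constructor
    · exact fun h => ⟨_, h, rfl, rfl, rfl⟩
    · rintro ⟨w, hw, h1, h2, h3⟩
      rwa [h1, h2, h3]
  rw [this]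
  exact MeasurableSet.biUnion (Set.to_countable R) fun w _ => (hg _).prod ((hg _).prod (hg _))

lemma generateFrom_finitelyDetermined :
    (inferInstance : MeasurableSpace (Y × Y × Y)) =
      MeasurableSpace.generateFrom (finitelyDetermined Y) := by
  refine le_antisymm ?_ (MeasurableSpace.generateFrom_le fun F hF =>
    measurableSet_of_mem_finitelyDetermined hF)
  have hcoord : ∀ g : Y × Y × Y → Y, (∀ A, MeasurableSet A → g ⁻¹' A ∈ finitelyDetermined Y) →
      MeasurableSpace.comap g mY ≤ MeasurableSpace.generateFrom (finitelyDetermined Y) := by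
    rintro g hg _ ⟨A, hA, rfl⟩
    exact MeasurableSpace.measurableSet_generateFrom (hg A hA)
  refine sup_le (hcoord _ fun A hA => (coordinate_mem_finitelyDetermined hA).1) ?_
  change MeasurableSpace.comap Prod.snd (MeasurableSpace.comap Prod.fst mY ⊔
    MeasurableSpace.comap Prod.snd mY) ≤ _
  rw [MeasurableSpace.comap_sup, MeasurableSpace.comap_comp, MeasurableSpace.comap_comp]
  exact sup_le (hcoord _ fun A hA => (coordinate_mem_finitelyDetermined hA).2.1)
    (hcoord _ fun A hA => (coordinate_mem_finitelyDetermined hA).2.2)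

/-- If two finite measures on `Y × Y × Y` are both asymptotically dominated by `ν n` on boxes, then
the measures that they give to complementary sets sum to at most the total mass of `ν n`. -/
lemma measure_add_measure_compl_le_of_le_liminf {ν : ℕ → Measure (Y × Y × Y)}
    {J₁ J₂ : Measure (Y × Y × Y)} [IsFiniteMeasure J₁] [IsFiniteMeasure J₂] {c : ENNReal}
    (hν : ∀ n, ν n Set.univ ≤ c)
    (h₁ : ∀ A B C : Set Y, MeasurableSet A → MeasurableSet B → MeasurableSet C →
      J₁ (A ×ˢ B ×ˢ C) ≤ liminf (fun n => ν n (A ×ˢ B ×ˢ C)) atTop)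
    (h₂ : ∀ A B C : Set Y, MeasurableSet A → MeasurableSet B → MeasurableSet C →
      J₂ (A ×ˢ B ×ˢ C) ≤ liminf (fun n => ν n (A ×ˢ B ×ˢ C)) atTop)
    {E : Set (Y × Y × Y)} (hE : MeasurableSet E) : J₁ E + J₂ Eᶜ ≤ c := by
  classical
  -- A finitely determined set is a finite disjoint union of boxes, and `liminf` is superadditive.
  have hF : ∀ (J : Measure (Y × Y × Y)), (∀ A B C : Set Y, MeasurableSet A → MeasurableSet B →
      MeasurableSet C → J (A ×ˢ B ×ˢ C) ≤ liminf (fun n => ν n (A ×ˢ B ×ˢ C)) atTop) →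
      ∀ F ∈ finitelyDetermined Y, J F ≤ liminf (fun n => ν n F) atTop := by
    rintro J hJ F ⟨ι, _, g, hg, R, rfl⟩
    simp only [measure_finitelyDetermined hg]
    exact (Finset.sum_le_sum fun w _ => hJ _ _ _ (hg _) (hg _) (hg _)).trans
      (ENNReal.sum_liminf_le _ _)
  have happrox : ∀ ε : ENNReal, 0 < ε → J₁ E + J₂ Eᶜ ≤ c + ε := by
    intro ε hε
    -- Approximating for `J₁ + J₂` handles both measures at once. `E` is never compared with `ν n`,
    -- which are not uniformly controlled off the ring; only `F` and `Fᶜ` are.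
    obtain ⟨F, hFmem, hFε⟩ := exists_measure_symmDiff_lt_of_generateFrom_isSetRing
      (μ := J₁ + J₂) isSetRing_finitelyDetermined
      ⟨{Set.univ}, Set.countable_singleton _,
        Set.singleton_subset_iff.2 univ_mem_finitelyDetermined, by simp⟩
      generateFrom_finitelyDetermined hE hε
    have hFc : Fᶜ ∈ finitelyDetermined Y := by
      rw [Set.compl_eq_univ_sdiff]
      exact isSetRing_finitelyDetermined.sdiff_mem univ_mem_finitelyDetermined hFmem
    have hFm := measurableSet_of_mem_finitelyDetermined hFmem
    have e1 : J₁ E ≤ J₁ F + J₁ (F ∆ E) := (measure_mono fun y hy => by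
      by_cases h : y ∈ F
      · exact Or.inl h
      · exact Or.inr (Or.inr ⟨hy, h⟩)).trans (measure_union_le _ _)
    have e2 : J₂ Eᶜ ≤ J₂ Fᶜ + J₂ (F ∆ E) := (measure_mono fun y hy => by
      by_cases h : y ∈ F
      · exact Or.inr (Or.inl ⟨h, hy⟩)
      · exact Or.inl h).trans (measure_union_le _ _)
    have e3 : J₁ F + J₂ Fᶜ ≤ c := by
      calc J₁ F + J₂ Fᶜ ≤ liminf (fun n => ν n F) atTop + liminf (fun n => ν n Fᶜ) atTop :=
            add_le_add (hF J₁ h₁ F hFmem) (hF J₂ h₂ _ hFc)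
        _ ≤ liminf (fun n => ν n F + ν n Fᶜ) atTop := ENNReal.liminf_add_liminf_le _ _
        _ ≤ liminf (fun _ => c) atTop := liminf_le_liminf (Eventually.of_forall fun n => by
            rw [measure_add_measure_compl hFm]
            exact hν n)
        _ = c := liminf_const c
    calc J₁ E + J₂ Eᶜ ≤ (J₁ F + J₁ (F ∆ E)) + (J₂ Fᶜ + J₂ (F ∆ E)) := add_le_add e1 e2
      _ = (J₁ F + J₂ Fᶜ) + (J₁ + J₂) (F ∆ E) := by
          rw [Measure.add_apply]
          ring
      _ ≤ c + ε := add_le_add e3 hFε.le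
  exact ENNReal.le_of_forall_pos_le_add fun ε hε _ => happrox ε (by exact_mod_cast hε)

end BoxApproximation

/-! ### Time reversal by the conjugacy, and separation of mixtures. -/

section Symmetry

variable {X : Type*} [MeasurableSpace X] {T : X ≃ᵐ X} {f : X → ℝ} {μ : Measure X}

/-- A conjugacy between the flow and its inverse exchanges the first two coordinates of the
off-diagonal joinings. -/
lemma flowJoining_preimage_conjugacy [SFinite μ] (hT : MeasurePreserving T μ μ)
    (hf : ∀ x, 0 < f x) (hfm : Measurable f) (hc : ∀ᵐ x ∂μ, Complete T f x)
    {S : SpecialSpace f → SpecialSpace f}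
    (hS : MeasurePreserving S (specialMeasure μ f) (specialMeasure μ f))
    (hconj : ∀ t : ℝ, ∀ᵐ y ∂specialMeasure μ f,
      S (specialFlow T f t y) = specialFlow T f (-t) (S y)) (t u : ℝ)
    {A B C : Set (SpecialSpace f)} (hA : MeasurableSet A) (hB : MeasurableSet B)
    (hC : MeasurableSet C) :
    flowJoining μ T f t u ((S ⁻¹' B) ×ˢ (S ⁻¹' A) ×ˢ (S ⁻¹' C)) =
      flowJoining μ T f t (t - u) (A ×ˢ B ×ˢ C) := by
  have hSm := hS.measurable
  have hTm := measurable_specialFlow_const (T := T) hf hfm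
  rw [flowJoining_apply hf hfm _ _ (hSm hB) (hSm hA) (hSm hC),
    flowJoining_apply hf hfm _ _ hA hB hC]
  have hE : MeasurableSet {y | y ∈ B ∧ specialFlow T f (-t) y ∈ A ∧ specialFlow T f (-u) y ∈ C} :=
    hB.inter ((hTm _ hA).inter (hTm _ hC))
  -- Applying `S` gives the times `(0, -t, -u)`; precomposing with the flow at time `t` gives `(t,
  -- 0, t - u)`, which is why `A` and `B` change places.
  calc specialMeasure μ f {y | y ∈ S ⁻¹' B ∧ specialFlow T f t y ∈ S ⁻¹' A ∧
        specialFlow T f u y ∈ S ⁻¹' C}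
      = specialMeasure μ f
        (S ⁻¹' {y | y ∈ B ∧ specialFlow T f (-t) y ∈ A ∧ specialFlow T f (-u) y ∈ C}) := by
        refine measure_congr_of_ae_iff ?_
        filter_upwards [hconj t, hconj u] with y h1 h2
        simp only [Set.mem_ofPred_eq, Set.mem_preimage, h1, h2]
    _ = specialMeasure μ f
        {y | y ∈ B ∧ specialFlow T f (-t) y ∈ A ∧ specialFlow T f (-u) y ∈ C} :=
        hS.measure_preimage hE.nullMeasurableSet
    _ = specialMeasure μ f (specialFlow T f t ⁻¹'
        {y | y ∈ B ∧ specialFlow T f (-t) y ∈ A ∧ specialFlow T f (-u) y ∈ C}) :=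
        ((measurePreserving_specialFlow hT hfm hf hc t).measure_preimage
          hE.nullMeasurableSet).symm
    _ = _ := by
        refine measure_congr_of_ae_iff ?_
        filter_upwards [ae_specialMeasure_of_ae hfm hc] with y hy
        simp only [Set.mem_ofPred_eq, Set.mem_preimage, specialFlow_specialFlow hf hy,
          add_neg_cancel, specialFlow_zero hf, ← sub_eq_add_neg]
        tauto

/-- Over an aperiodic base point with complete flow line, the orbit map of the special flow is
injective. -/
lemma specialFlow_injective (hf : ∀ x, 0 < f x) {y : SpecialSpace f}
    (hc : Complete T f y.1.1) (ha : ∀ n : ℤ, iter T n y.1.1 = y.1.1 → n = 0) :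
    Function.Injective fun t => specialFlow T f t y := by
  intro s t hst
  obtain ⟨m, hm⟩ := hc (y.1.2 + s)
  obtain ⟨n, hn⟩ := hc (y.1.2 + t)
  have h := congrArg Subtype.val hst
  simp only [specialFlow_of_inPassage hf hm, specialFlow_of_inPassage hf hn, Prod.mk.injEq] at h
  have hmn : m = n := by
    have := ha (-n + m) (by rw [iter_add, h.1, iter_neg_iter])
    omega
  subst hmn
  linarith [h.2]

/-- The flow triple of a point with times `-p.1` and `-p.2`. -/
def timedTriple (T : X ≃ᵐ X) (f : X → ℝ) (w : (ℝ × ℝ) × SpecialSpace f) :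
    SpecialSpace f × SpecialSpace f × SpecialSpace f :=
  (w.2, specialFlow T f (-w.1.1) w.2, specialFlow T f (-w.1.2) w.2)

lemma measurable_timedTriple (hf : ∀ x, 0 < f x) (hfm : Measurable f) :
    Measurable (timedTriple T f) := by
  have h := measurable_specialFlow (T := T) hf hfm
  have h1 : Measurable fun w : (ℝ × ℝ) × SpecialSpace f => specialFlow T f (-w.1.1) w.2 :=
    h.comp (g := fun z : ℝ × SpecialSpace f => specialFlow T f z.1 z.2)
      (f := fun w : (ℝ × ℝ) × SpecialSpace f => (-w.1.1, w.2)) (by fun_prop)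
  have h2 : Measurable fun w : (ℝ × ℝ) × SpecialSpace f => specialFlow T f (-w.1.2) w.2 :=
    h.comp (g := fun z : ℝ × SpecialSpace f => specialFlow T f z.1 z.2)
      (f := fun w : (ℝ × ℝ) × SpecialSpace f => (-w.1.2, w.2)) (by fun_prop)
  exact measurable_snd.prodMk (h1.prodMk h2)

/-- The mixture over `Q` of off-diagonal self-joinings. -/
def mixedJoining (μ : Measure X) (T : X ≃ᵐ X) (f : X → ℝ) (Q : Measure (ℝ × ℝ)) :
    Measure (SpecialSpace f × SpecialSpace f × SpecialSpace f) :=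
  (Q.prod (specialMeasure μ f)).map (timedTriple T f)

lemma mixedJoining_apply (hf : ∀ x, 0 < f x) (hfm : Measurable f)
    [IsFiniteMeasure (specialMeasure μ f)] (Q : Measure (ℝ × ℝ))
    {E : Set (SpecialSpace f × SpecialSpace f × SpecialSpace f)} (hE : MeasurableSet E) :
    mixedJoining μ T f Q E = ∫⁻ p, flowJoining μ T f (-p.1) (-p.2) E ∂Q := by
  have hm := measurable_timedTriple (T := T) hf hfm
  rw [mixedJoining, Measure.map_apply hm hE, Measure.prod_apply (hm hE)]
  refine lintegral_congr fun p => ?_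
  rw [flowJoining, Measure.map_apply (measurable_flowTriple hf hfm _ _) hE]
  rfl

lemma measurable_flowJoining_apply (hf : ∀ x, 0 < f x) (hfm : Measurable f)
    [IsFiniteMeasure (specialMeasure μ f)]
    {E : Set (SpecialSpace f × SpecialSpace f × SpecialSpace f)} (hE : MeasurableSet E) :
    Measurable fun p : ℝ × ℝ => flowJoining μ T f (-p.1) (-p.2) E := by
  have := measurable_measure_prodMk_left (ν := specialMeasure μ f)
    (measurable_timedTriple (T := T) hf hfm hE)
  convert this using 2 with p
  rw [flowJoining, Measure.map_apply (measurable_flowTriple hf hfm _ _) hE]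
  rfl

instance [IsFiniteMeasure (specialMeasure μ f)] (Q : Measure (ℝ × ℝ)) [IsFiniteMeasure Q] :
    IsFiniteMeasure (mixedJoining μ T f Q) :=
  inferInstanceAs (IsFiniteMeasure (Measure.map _ _))

/-- Mixtures of off-diagonal joinings over disjoint sets of times are mutually singular. -/
lemma exists_measurableSet_separating_mixedJoining [StandardBorelSpace X]
    [IsFiniteMeasure (specialMeasure μ f)] (hf : ∀ x, 0 < f x) (hfm : Measurable f)
    (hc : ∀ᵐ x ∂μ, Complete T f x) (ha : ∀ᵐ x ∂μ, ∀ n : ℤ, iter T n x = x → n = 0)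
    {D : Set (ℝ × ℝ)} (hD : MeasurableSet D) :
    ∃ E, MeasurableSet E ∧ ∀ (Q : Measure (ℝ × ℝ)) [SFinite Q],
      mixedJoining μ T f Q E = Q D * specialMeasure μ f Set.univ ∧
      mixedJoining μ T f Q Eᶜ = Q Dᶜ * specialMeasure μ f Set.univ := by
  have : StandardBorelSpace (SpecialSpace f) := (measurableSet_underGraph hfm).standardBorel
  have hae := (ae_specialMeasure_of_ae hfm hc).and (ae_specialMeasure_of_ae hfm ha)
  obtain ⟨N, hNsub, hNm, hN0⟩ := exists_measurable_superset_of_null (ae_iff.1 hae)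
  have hgood : ∀ y ∉ N, Complete T f y.1.1 ∧ ∀ n : ℤ, iter T n y.1.1 = y.1.1 → n = 0 :=
    fun y hy => by
      by_contra hcon
      exact hy (hNsub hcon)
  have hm := measurable_timedTriple (T := T) hf hfm
  -- The first coordinate recovers the point, and freeness of the flow recovers both times.
  have hinj : Set.InjOn (timedTriple T f) (Set.univ ×ˢ Nᶜ) := by
    rintro ⟨p, y⟩ ⟨-, hy⟩ ⟨p', y'⟩ ⟨-, -⟩ h
    simp only [timedTriple, Prod.mk.injEq] at h
    obtain ⟨rfl, h1, h2⟩ := h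
    have hi := specialFlow_injective hf (hgood y hy).1 (hgood y hy).2
    have e1 : p.1 = p'.1 := neg_injective (hi h1)
    have e2 : p.2 = p'.2 := neg_injective (hi h2)
    rw [Prod.ext e1 e2]
  -- Injectivity makes the image measurable (Lusin–Souslin). The set depends on `D` only, so it
  -- serves both mixtures.
  refine ⟨timedTriple T f '' (D ×ˢ Nᶜ), (hD.prod hNm.compl).image_of_measurable_injOn hm
    (hinj.mono (Set.prod_mono (Set.subset_univ _) subset_rfl)), fun Q _ => ?_⟩
  have hEm := (hD.prod hNm.compl).image_of_measurable_injOn hm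
    (hinj.mono (Set.prod_mono (Set.subset_univ _) subset_rfl))
  have hiff : ∀ᵐ w ∂Q.prod (specialMeasure μ f),
      timedTriple T f w ∈ timedTriple T f '' (D ×ˢ Nᶜ) ↔ w.1 ∈ D := by
    have hNae : ∀ᵐ w : (ℝ × ℝ) × SpecialSpace f ∂Q.prod (specialMeasure μ f), w.2 ∉ N :=
      Measure.quasiMeasurePreserving_snd.ae (measure_eq_zero_iff_ae_notMem.1 hN0)
    filter_upwards [hNae] with w hw
    constructor
    · rintro ⟨w', hw', h⟩
      rw [← hinj ⟨trivial, hw'.2⟩ ⟨trivial, hw⟩ h]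
      exact hw'.1
    · exact fun h => ⟨w, ⟨h, hw⟩, rfl⟩
  constructor
  · rw [mixedJoining, Measure.map_apply hm hEm, ← Measure.prod_prod]
    refine measure_congr_of_ae_iff (hiff.mono fun w hw => ?_)
    simpa using hw
  · rw [mixedJoining, Measure.map_apply hm hEm.compl, ← Measure.prod_prod]
    refine measure_congr_of_ae_iff (hiff.mono fun w hw => ?_)
    simpa using not_congr hw

end Symmetry

end

/-! ### The main theorem. -/

theorem theorem4p2 {X : Type*} [MeasurableSpace X] [StandardBorelSpace X]
    (μ : Measure X) [IsProbabilityMeasure μ] [NullSingletonClass μ]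
    (T : X ≃ᵐ X) (hT : Ergodic T μ)
    (f : X → ℝ) (hf_meas : Measurable f) (hf_pos : ∀ x, 0 < f x) (hf_L2 : MemLp f 2 μ)
    (W : ℕ → Set X) (hW : ∀ n, MeasurableSet (W n))
    (q : ℕ → ℕ) (a : ℕ → ℝ) (α : ℝ)
    (P : Measure (ℝ × ℝ)) [IsProbabilityMeasure P]
    (h : PartialRigidityConditions μ T f W q (fun n => 2 * q n) a (fun n => 2 * a n) α P)
    (m : ℕ) (c d : Fin (m + 1) → ℝ) (hc : ∀ i, 0 ≤ c i)
    (hP : P.map (fun p : ℝ × ℝ => p.1 - 2 * p.2) =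
      ∑ i, ENNReal.ofReal (c i) • Measure.dirac (d i))
    (hd0 : d 0 = 0)
    (hsum : (1 - α) / α < ∑ i : Fin m, c i.succ)
    (hd : ∀ i j, i ≠ j → d i ≠ -d j) :
    ¬ FlowIsomorphic (specialMeasure μ f) (specialFlow T f)
      (specialMeasure μ f) (fun t => specialFlow T f (-t)) := by
  rintro ⟨S, -, hS, -, -, -, hconj⟩
  have hfi : Integrable f μ := memLp_one_iff_integrable.1 (hf_L2.mono_exponent (by norm_num))
  have hcomp := ae_complete hT.toMeasurePreserving hf_meas hf_pos
  have hfin := isFiniteMeasure_specialMeasure (μ := μ) hf_meas hfi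
  have hξ : Measurable fun p : ℝ × ℝ => p.1 - 2 * p.2 := by fun_prop
  have hτ : Measurable fun p : ℝ × ℝ => (p.1, p.1 - p.2) := by fun_prop
  have hDm : MeasurableSet (Set.range d) := (Set.finite_range d).measurableSet
  have hPτ : IsProbabilityMeasure (P.map fun p : ℝ × ℝ => (p.1, p.1 - p.2)) :=
    Measure.isProbabilityMeasure_map hτ.aemeasurable
  let D : Set (ℝ × ℝ) := (fun p => p.1 - 2 * p.2) ⁻¹' Set.range d
  have hD : MeasurableSet D := hξ hDm
  have hPD : P D = 1 := by
    rw [prob_compl_eq_zero_iff hD |>.symm, ← Set.preimage_compl,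
      ← Measure.map_apply hξ hDm.compl, hP]
    simp [hDm]
  have hPD' : ENNReal.ofReal (∑ i : Fin m, c i.succ) ≤
      P.map (fun p : ℝ × ℝ => (p.1, p.1 - p.2)) Dᶜ := by
    have hD'm : MeasurableSet (Set.range fun i : Fin m => d i.succ) :=
      (Set.finite_range _).measurableSet
    calc ENNReal.ofReal (∑ i : Fin m, c i.succ)
        ≤ P.map (fun p : ℝ × ℝ => p.1 - 2 * p.2) (Set.range fun i : Fin m => d i.succ) := by
          rw [hP, ENNReal.ofReal_sum_of_nonneg fun i _ => hc _, Measure.finsetSum_apply,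
            Fin.sum_univ_succ]
          refine le_add_left (Finset.sum_le_sum fun i _ => ?_)
          simp [hD'm]
      _ = P ((fun p : ℝ × ℝ => p.1 - 2 * p.2) ⁻¹' Set.range fun i : Fin m => d i.succ) :=
          Measure.map_apply hξ hD'm
      _ ≤ P ((fun p : ℝ × ℝ => (p.1, p.1 - p.2)) ⁻¹' Dᶜ) := by
          refine measure_mono ?_
          rintro p ⟨i, hi⟩ ⟨j, hj⟩
          -- The map `(x,y) ↦ (x, x - y)` changes the sign of `x - 2y`.
          have hij : d i.succ = -d j := by
            simp only at hi hj
            linarith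
          -- When the indices agree, `d i.succ = -d i.succ` forces the value `0 = -d 0`, excluded by
          -- comparison with index `0`.
          by_cases hne : i.succ = j
          · have h0 : d i.succ = -d 0 := by
              rw [← hne] at hij
              linarith
            exact hd _ _ (Fin.succ_ne_zero i) h0
          · exact hd _ _ hne hij
      _ = _ := (Measure.map_apply hτ hD.compl).symm
  obtain ⟨E, hE, hsep⟩ := exists_measurableSet_separating_mixedJoining (μ := μ) hf_pos hf_meas
    hcomp (ae_iter_ne hT) hD
  have hfinP := (mixedJoining μ T f P).smul_finite (c := ENNReal.ofReal α) ENNReal.ofReal_ne_top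
  have hfinPτ := (mixedJoining μ T f (P.map fun p : ℝ × ℝ => (p.1, p.1 - p.2))).smul_finite
    (c := ENNReal.ofReal α) ENNReal.ofReal_ne_top
  have hmass := measure_add_measure_compl_le_of_le_liminf
    (ν := fun n => flowJoining μ T f (2 * a n) (a n))
    (J₁ := ENNReal.ofReal α • mixedJoining μ T f P)
    (J₂ := ENNReal.ofReal α • mixedJoining μ T f (P.map fun p : ℝ × ℝ => (p.1, p.1 - p.2)))
    (c := specialMeasure μ f Set.univ) ?_ ?_ ?_ hE
  · rw [Measure.smul_apply, Measure.smul_apply, smul_eq_mul, smul_eq_mul, (hsep _).1, (hsep _).2,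
      hPD, one_mul, ← mul_assoc, ← add_mul] at hmass
    have hle : ENNReal.ofReal α +
        ENNReal.ofReal α * P.map (fun p : ℝ × ℝ => (p.1, p.1 - p.2)) Dᶜ ≤ 1 := by
      rwa [← ENNReal.mul_le_mul_iff_left (specialMeasure_univ_pos (μ := μ) hf_meas hf_pos)
        (measure_ne_top _ _), one_mul]
    have hle' := (add_le_add_right (mul_le_mul_right hPD' _) _).trans hle
    have hs0 : 0 ≤ ∑ i : Fin m, c i.succ := Finset.sum_nonneg fun i _ => hc _
    rw [← ENNReal.ofReal_mul h.pos.le, ← ENNReal.ofReal_add h.pos.le (mul_nonneg h.pos.le hs0),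
      ENNReal.ofReal_le_one] at hle'
    rw [div_lt_iff₀ h.pos] at hsum
    linarith
  · intro n
    rw [flowJoining, Measure.map_apply (measurable_flowTriple hf_pos hf_meas _ _)
      MeasurableSet.univ, Set.preimage_univ]
  · intro A B C hA hB hC
    rw [Measure.smul_apply, smul_eq_mul,
      mixedJoining_apply hf_pos hf_meas _ (hA.prod (hB.prod hC))]
    exact mixture_le_liminf_flowJoining hT hf_meas hf_pos hfi hW h hA hB hC
  · intro A B C hA hB hC
    have hbox : MeasurableSet (A ×ˢ B ×ˢ C) := hA.prod (hB.prod hC)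
    have hsymm := flowJoining_preimage_conjugacy (T := T) (μ := μ) hT.toMeasurePreserving hf_pos
      hf_meas hcomp hS hconj (hA := hA) (hB := hB) (hC := hC)
    have hle := mixture_le_liminf_flowJoining hT hf_meas hf_pos hfi hW h (hS.measurable hB)
      (hS.measurable hA) (hS.measurable hC)
    simp only [hsymm] at hle
    rw [Measure.smul_apply, smul_eq_mul, mixedJoining_apply hf_pos hf_meas _ hbox,
      lintegral_map (measurable_flowJoining_apply (μ := μ) (T := T) hf_pos hf_meas hbox) hτ]
    -- The remaining goals match times: `-(x - y) = -x - (-y)` in the mixture and `a n = 2 * a n - a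
    -- n` in the joinings.
    convert hle using 5
    · congr 1
      ring
    · ring
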